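/- Let $\mathcal G$ be the dumbbell graph: two vertices, a loop $e_1$ at the first, a loop $e_2$ at the second, and an edge $e_3$ (the bridge) joining them. Replace each edge by two opposite directed edges $e,\bar e$, let $A(e,e')=1$ if $e'$ begins where $e$ ends and $e'\ne\bar e$, and $A(e,e')=0$ otherwise, and let $(\Sigma_A^+,\sigma)$ be the one-sided subshift of finite type of $A$. For $l:\{e_1,e_2,e_3\}\to\mathbb R_{>0}$ (with $l(\bar e)=l(e)$) let $$h(l)=\lim_{T\to\infty}\tfrac1T\log\#\{\gamma:\ l(\gamma)<T\},$$ where $\gamma=(\epsilon_0,\epsilon_1,\dots,\epsilon_n=\epsilon_0)$, $n\ge1$, runs over the closed cycles of directed edges with $A(\epsilon_i,\epsilon_{i+1})=1$ for $0\le i<n$, and $l(\gamma)=\sum_{i<n}l(\epsilon_i)$. Let $\mathcal M^1=\{l>0:\ h(l)=1\}\subset\mathbb R^3$. Regard functions $\phi$ of the edges as functions $\phi(\underline e)=\phi(e_0)$ on $\Sigma_A^+$. For $l\in\mathcal M^1$ let $m_{-l}$ be the equilibrium state of $-l$, i.e. $m_{-l}=v\mu/\int v\,d\mu$ with $v>0$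 continuous, $\mu$ a probability measure, $\mathcal L_{-l}v=v$, $\mathcal L_{-l}^*\mu=\mu$, where $(\mathcal L_{-l}w)(\underline x)=\sum_{\sigma\underline y=\underline x}e^{-l(\underline y)}w(\underline y)$. The pressure metric is $$\|\phi\|_P^2=\mathrm{Var}(\phi,m_{-l})=\lim_{n\to\infty}\frac1n\int\Big(\sum_{i<n}\phi\circ\sigma^i-n\int\phi\,dm_{-l}\Big)^2dm_{-l}$$ for $\phi$ tangent to $\mathcal M^1$ at $l$, and $d_P(l,l')$ is the infimum of $\int_0^1\|\dot\gamma\|_P\,dt$ over continuously differentiable curves $\gamma:[0,1]\to\mathcal M^1$ from $l$ to $l'$. Then: 1. $\mathcal M^1$ is the surface $\{(x,y,\log 2-\tfrac12\log((e^x-1)(e^y-1))):\ (x,y)\in U\}$, where $x=l(e_1)$, $y=l(e_2)$ and $U=\{x>0,\ y>0,\ (e^x-1)(e^y-1)<4\}$. For every $l\in\mathcal M^1$ the equilibrium state $m_{-l}$ exists and is unique, and the limit defining the variance exists for every function $\phi$ of the edges. 2. In the coordinates $(x,y)\in U$, $\|\cdot\|_P$ is a smooth Riemannian metric and it is diagonal: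 its first fundamental form has $F=0$ and $E,G>0$. 3. Its Gaussian curvature at $(x,y)\in U$ is $$K_P(x,y)=\frac{2e^{x+y}-1}{4e^{x+y}-3e^x-3e^y+2}.$$ 4. There is a constant $c_0>0$ with $K_P\ge c_0$ on $U$, but $K_P$ is not bounded above on $U$; in fact $K_P(x,y)\to\infty$ as $(x,y)\to(0,0)$ in $U$. 5. $(\mathcal M^1,d_P)$ is incomplete: there is a $d_P$-Cauchy sequence in $\mathcal M^1$ that does not $d_P$-converge to a point of $\mathcal M^1$. -/

import Mathlib

open Filter Topology MeasureTheory

noncomputable section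

/-- A finite undirected multigraph (loops and multiple edges allowed). Each edge carries an auxiliary
ordering of its two endpoints, used only to name its two directions. -/
structure FinGraph where
  numVertices : ℕ
  numEdges : ℕ
  ends : Fin numEdges → Fin numVertices × Fin numVertices

namespace FinGraph

variable (G : FinGraph)

/-- Edge functions; the edge weightings are the positive ones. -/
abbrev EdgeFun : Type := Fin G.numEdges → ℝ

/-- Directed edges: `(e, true)` is `e` in its chosen direction, `(e, false)` is its reversal. -/
abbrev DEdge : Type := Fin G.numEdges × Bool

/-- The same edge with the opposite direction. -/
def rev (e : G.DEdge) : G.DEdge := (e.1, !e.2)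

/-- Initial vertex of a directed edge. -/
def init (e : G.DEdge) : Fin G.numVertices := if e.2 then (G.ends e.1).1 else (G.ends e.1).2

/-- Terminal vertex of a directed edge. -/
def term (e : G.DEdge) : Fin G.numVertices := if e.2 then (G.ends e.1).2 else (G.ends e.1).1

/-- The relation `A(e, e') = 1`: the directed edge `e'` follows `e` and is not the reversal of `e`. -/
def Adj (e e' : G.DEdge) : Prop := G.term e = G.init e' ∧ e' ≠ G.rev e

/-- The closed cycles without backtracking `γ = (e₀, e₁, …, eₙ = e₀)`, `n ≥ 1`, of length
`l(e₀) + ⋯ + l(eₙ₋₁) < T`. -/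
def cyclesBelow (l : G.EdgeFun) (T : ℝ) : Set (Σ n : ℕ, Fin (n + 1) → G.DEdge) :=
  {γ | 1 ≤ γ.1 ∧ (∀ i : Fin γ.1, G.Adj (γ.2 i.castSucc) (γ.2 i.succ)) ∧
    γ.2 (Fin.last γ.1) = γ.2 0 ∧ ∑ i : Fin γ.1, l (γ.2 i.castSucc).1 < T}

/-- The metric graph `(G, l)` has entropy `h`: the limit of `(1/T) log #{γ : l(γ) < T}` exists
and equals `h`. -/
def HasEntropy (l : G.EdgeFun) (h : ℝ) : Prop :=
  Tendsto (fun T : ℝ => 1 / T * Real.log ((G.cyclesBelow l T).ncard : ℝ)) atTop (𝓝 h)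

/-- The moduli space of edge weightings with entropy one. -/
def moduliOne : Set G.EdgeFun := {l | (∀ e, 0 < l e) ∧ G.HasEntropy l 1}

/-- The one-sided subshift of finite type of `A`, with the product topology and Borel structure. -/
abbrev Path : Type := {x : ℕ → G.DEdge // ∀ n, G.Adj (x n) (x (n + 1))}

variable {G}

/-- The shift map. -/
def shift (x : G.Path) : G.Path := ⟨fun n => x.1 (n + 1), fun n => x.2 (n + 1)⟩

/-- The locally constant function on the shift space given by an edge function. -/
def onPath (φ : G.EdgeFun) (x : G.Path) : ℝ := φ (x.1 0).1

/-- The transfer operator `(L_f w)(x) = ∑_{σ y = x} e^{f(y)} w(y)` (a finite sum). -/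
def transfer (f w : G.Path → ℝ) (x : G.Path) : ℝ :=
  ∑ᶠ (y : G.Path) (_ : shift y = x), Real.exp (f y) * w y

/-- `m` is an equilibrium state of the pressure-zero function `f`: `m = v μ / ∫ v dμ`, where `v` is a
strictly positive continuous function with `L_f v = v` and `μ` is a Borel probability measure with
`L_f^* μ = μ`. (A strictly positive eigenfunction belongs to the spectral radius of `L_f`, so that
eigenvalue one says that the pressure of `f` is zero.) -/
def IsEquilibriumState (f : G.Path → ℝ) (m : Measure G.Path) : Prop :=
  ∃ (v : G.Path → ℝ) (μ : Measure G.Path),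
    Continuous v ∧ (∀ x, 0 < v x) ∧ (∀ x, transfer f v x = v x) ∧
    IsProbabilityMeasure μ ∧
    (∀ φ : G.Path → ℝ, Continuous φ → ∫ x, transfer f φ x ∂μ = ∫ x, φ x ∂μ) ∧
    m = (ENNReal.ofReal (∫ x, v x ∂μ))⁻¹ • μ.withDensity (fun x => ENNReal.ofReal (v x))

open Classical in
/-- The equilibrium state of `f` (zero if there is none). -/
def equilibriumState (f : G.Path → ℝ) : Measure G.Path :=
  if h : ∃ m, IsEquilibriumState f m then h.choose else 0

/-- The equilibrium state `m_{-l}` of an edge weighting. -/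
def eqState (l : G.EdgeFun) : Measure G.Path := equilibriumState (fun x => - onPath l x)

/-- `(1/n) ∫ (wⁿ - n ∫ w dμ)² dμ`, where `wⁿ` is the `n`-th Birkhoff sum of `w`. -/
def varianceSeq (w : G.Path → ℝ) (μ : Measure G.Path) (n : ℕ) : ℝ :=
  1 / (n : ℝ) * ∫ x, (birkhoffSum shift w n x - n * ∫ z, w z ∂μ) ^ 2 ∂μ

/-- The dynamical variance `Var(w, μ)`. -/
def dynVar (w : G.Path → ℝ) (μ : Measure G.Path) : ℝ := limUnder atTop (varianceSeq w μ)

/-- The square of the pressure norm, `‖φ‖_P² = Var(φ, m_{-l})`. -/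
def pressureSq (l φ : G.EdgeFun) : ℝ := dynVar (onPath φ) (eqState l)

/-- The bilinear form of the pressure metric, obtained by polarization. -/
def pressureInner (l φ ψ : G.EdgeFun) : ℝ :=
  1 / 2 * (pressureSq l (φ + ψ) - pressureSq l φ - pressureSq l ψ)

/-- The pressure length of a curve defined on `[0, 1]`. -/
def pressureLength (γ : ℝ → G.EdgeFun) : ENNReal :=
  ∫⁻ t in Set.Icc (0 : ℝ) 1,
    ENNReal.ofReal (Real.sqrt (pressureSq (γ t) (derivWithin γ (Set.Icc 0 1) t)))

/-- The path distance of the pressure metric: the infimum of the lengths of the continuously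
differentiable curves `[0, 1] → M¹` from `l₁` to `l₂`. -/
def pressureDist (l₁ l₂ : G.EdgeFun) : ENNReal :=
  ⨅ (γ : ℝ → G.EdgeFun) (_ : ContDiffOn ℝ 1 γ (Set.Icc 0 1) ∧
    (∀ t ∈ Set.Icc (0 : ℝ) 1, γ t ∈ G.moduliOne) ∧ γ 0 = l₁ ∧ γ 1 = l₂), pressureLength γ

variable (G) in
/-- The space `M¹` is complete for the path distance of the pressure metric: every Cauchy sequence
in it converges to a point of it. -/
def PressureComplete : Prop :=
  ∀ u : ℕ → G.EdgeFun, (∀ n, u n ∈ G.moduliOne) →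
    (∀ ε : ENNReal, 0 < ε → ∃ N, ∀ m ≥ N, ∀ n ≥ N, pressureDist (u m) (u n) < ε) →
    ∃ l ∈ G.moduliOne, Tendsto (fun n => pressureDist (u n) l) atTop (𝓝 0)

end FinGraph

/-- The `i`-th partial derivative of a function of two real variables. -/
def partialD {F : Type*} [NormedAddCommGroup F] [NormedSpace ℝ F] (i : Fin 2)
    (f : (Fin 2 → ℝ) → F) (p : Fin 2 → ℝ) : F :=
  lineDeriv ℝ f p (Pi.single i 1)

/-- The Christoffel symbol `Γᵏᵢⱼ` of a metric `g` in two coordinates. -/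
def christoffel (g : (Fin 2 → ℝ) → Matrix (Fin 2) (Fin 2) ℝ) (k i j : Fin 2) (p : Fin 2 → ℝ) : ℝ :=
  1 / 2 * ∑ m, (g p)⁻¹ k m *
    (partialD i (fun q => g q j m) p + partialD j (fun q => g q i m) p
      - partialD m (fun q => g q i j) p)

/-- The `m`-th component of `R(∂ᵢ, ∂ⱼ)∂ₖ`. -/
def curvatureTensor (g : (Fin 2 → ℝ) → Matrix (Fin 2) (Fin 2) ℝ) (m k i j : Fin 2)
    (p : Fin 2 → ℝ) : ℝ :=
  partialD i (christoffel g m j k) p - partialD j (christoffel g m i k) p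
    + ∑ s, (christoffel g s j k p * christoffel g m i s p
      - christoffel g s i k p * christoffel g m j s p)

/-- The Gaussian curvature `g(R(∂₁, ∂₂)∂₂, ∂₁) / det g` of a metric in two coordinates. -/
def gaussCurvature (g : (Fin 2 → ℝ) → Matrix (Fin 2) (Fin 2) ℝ) (p : Fin 2 → ℝ) : ℝ :=
  (∑ m, g p 0 m * curvatureTensor g m 1 0 1 p) / (g p).det

/-- The first fundamental form of the pressure metric along a parametrized surface `Φ`. -/
def pressureForm {G : FinGraph} (Φ : (Fin 2 → ℝ) → G.EdgeFun) (p : Fin 2 → ℝ) :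
    Matrix (Fin 2) (Fin 2) ℝ :=
  Matrix.of fun i j => FinGraph.pressureInner (Φ p) (partialD i Φ p) (partialD j Φ p)

/-- The dumbbell: two vertices, a loop at each of them (edges `0` and `1`), and a bridge (edge `2`). -/
def dumbbell : FinGraph where
  numVertices := 2
  numEdges := 3
  ends := ![(0, 0), (1, 1), (0, 1)]

/-- The coordinate domain `x, y > 0`, `(eˣ - 1)(eʸ - 1) < 4`. -/
def dumbbellDomain : Set (Fin 2 → ℝ) :=
  {p | 0 < p 0 ∧ 0 < p 1 ∧ (Real.exp (p 0) - 1) * (Real.exp (p 1) - 1) < 4}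

/-- The map `(x, y) ↦ (x, y, log 2 - (1/2) log ((eˣ - 1)(eʸ - 1)))`. -/
def dumbbellChart (p : Fin 2 → ℝ) : dumbbell.EdgeFun :=
  ![p 0, p 1,
    Real.log 2 - 1 / 2 * Real.log ((Real.exp (p 0) - 1) * (Real.exp (p 1) - 1))]

/-- The first fundamental form of the pressure metric of the dumbbell in the coordinates `(x, y)`. -/
def dumbbellForm : (Fin 2 → ℝ) → Matrix (Fin 2) (Fin 2) ℝ := pressureForm dumbbellChart

end

/-! Everything is governed by the matrix W(e, e') = A(e, e') exp(-l(e)). Suppose that W has positive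
left and right eigenvectors for the eigenvalue one and that the graph is irreducible. The left
eigenvector, read at the first edge, is up to a scalar the only continuous eigenfunction of the
transfer operator (`Perron.eigenfunction_eq`). Dividing by it turns the operator into the averaging
operator of a Markov chain run backwards, and this determines the equilibrium state on cylinders
(`Perron.IsInvariant.unique`). The right eigenvector gives the forward Markov chain whose law is the
eigenmeasure, hence existence. A solution of Poisson's equation for the backward chain writes an
edge function as a constant plus a reversed martingale difference plus a coboundary, so the variance
exists and is a finite sum (`Perron.IsInvariant.tendsto_varianceSeq`).

The entropy is found by counting. If u is a positive right eigenvector for the weighting h l, then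
u(e) exp(hT) solves the recursion obtained by removing the first edge of a path, so the number of
paths of length below T is pinched between multiples of exp(hT) (`hasEntropy_of_eigenvector`). For
the dumbbell the eigenvalue equation is (e^x - 1)(e^y - 1) e^{2z} = 4, where z is the length of the
bridge, and z > 0 is the inequality that defines U.

Put a = e^x, b = e^y, s = 1/(a - 1), t = 1/(b - 1). The stationary chain crosses the bridge in each
direction with frequency k = 1/(4 + s + t), and between crossings it makes a geometric number of
turns round a loop, of variance A = a/(a - 1)^2 or B = b/(b - 1)^2. Tangent vectors are the edge
functions of mean zero, and their variance is k(A dx^2 + B dy^2). So F = 0, E = kA, G = kB. Since dk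
= k^2(A dx + B dy), one has E_y = G_x = EG, which makes the curvature a short computation.

For incompleteness, k is Lipschitz for the metric, because k^3(A + B) ≤ 1, and it is positive on the
surface. The curve e^x = 1 + r^2, e^y = 2 has finite length as r → 0 while k → 0 along it, so a
limit point would have k = 0. -/

noncomputable section

/-! ### The path space and its transfer operator -/

namespace FinGraph

variable {G : FinGraph}

instance decidableAdj : DecidableRel G.Adj := fun e e' =>
  inferInstanceAs (Decidable (G.term e = G.init e' ∧ e' ≠ G.rev e))

/-- The weighted adjacency matrix `A(e, e') e^{-l(e)}`. -/
def weight (l : G.EdgeFun) (e e' : G.DEdge) : ℝ := if G.Adj e e' then Real.exp (-l e.1) else 0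

theorem weight_nonneg (l : G.EdgeFun) (e e' : G.DEdge) : 0 ≤ weight l e e' := by
  unfold weight; split_ifs <;> positivity

theorem weight_of_adj {l : G.EdgeFun} {e e' : G.DEdge} (h : G.Adj e e') :
    weight l e e' = Real.exp (-l e.1) := if_pos h

theorem weight_pos {l : G.EdgeFun} {e e' : G.DEdge} (h : G.Adj e e') : 0 < weight l e e' := by
  rw [weight_of_adj h]; positivity

theorem weight_of_not_adj {l : G.EdgeFun} {e e' : G.DEdge} (h : ¬ G.Adj e e') :
    weight l e e' = 0 := if_neg h

/-- Prepend a directed edge to a path, if possible; otherwise leave the path unchanged. -/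
def cons (e : G.DEdge) (x : G.Path) : G.Path :=
  if h : G.Adj e (x.1 0) then
    ⟨fun n => Nat.casesOn n e x.1, fun n => by
      cases n with
      | zero => exact h
      | succ n => exact x.2 n⟩
  else x

theorem cons_zero {e : G.DEdge} {x : G.Path} (h : G.Adj e (x.1 0)) : (cons e x).1 0 = e := by
  simp [cons, h]

theorem cons_succ {e : G.DEdge} {x : G.Path} (h : G.Adj e (x.1 0)) (n : ℕ) :
    (cons e x).1 (n + 1) = x.1 n := by
  simp [cons, h]

theorem shift_cons {e : G.DEdge} {x : G.Path} (h : G.Adj e (x.1 0)) : shift (cons e x) = x :=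
  Subtype.ext (funext fun n => cons_succ h n)

theorem cons_head_shift (x : G.Path) : cons (x.1 0) (shift x) = x := by
  have h : G.Adj (x.1 0) ((shift x).1 0) := x.2 0
  refine Subtype.ext (funext fun n => ?_)
  cases n with
  | zero => exact cons_zero h
  | succ n => exact cons_succ h n

theorem shift_preimage (x : G.Path) :
    {y : G.Path | shift y = x} = (fun e => cons e x) '' {e | G.Adj e (x.1 0)} := by
  ext y
  constructor
  · rintro rfl
    exact ⟨y.1 0, y.2 0, cons_head_shift y⟩
  · rintro ⟨e, h, rfl⟩
    exact shift_cons h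

/-- The preimages of `x` under the shift are the paths `cons e x` with `e` admissible. For other `e`
the weight vanishes, so the default value of `cons` never matters and the sum may run over all
edges. -/
theorem transfer_eq_sum (l : G.EdgeFun) (w : G.Path → ℝ) (x : G.Path) :
    transfer (fun y => - onPath l y) w x = ∑ e, weight l e (x.1 0) * w (cons e x) := by
  have h1 : transfer (fun y => - onPath l y) w x =
      ∑ᶠ y ∈ {y : G.Path | shift y = x}, Real.exp (-onPath l y) * w y := rfl
  have hinj : Set.InjOn (fun e => cons e x) {e | G.Adj e (x.1 0)} := by
    intro e he e' he' h
    have := congrArg (fun y : G.Path => y.1 0) h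
    simpa [cons_zero he, cons_zero he'] using this
  rw [h1, shift_preimage, finsum_mem_image hinj]
  have h2 : {e | G.Adj e (x.1 0)} = ((Finset.univ.filter fun e => G.Adj e (x.1 0) :
      Finset G.DEdge) : Set G.DEdge) := by ext; simp
  rw [h2, finsum_mem_coe_finset, Finset.sum_filter]
  refine Finset.sum_congr rfl fun e _ => ?_
  split_ifs with h
  · rw [weight_of_adj h, onPath, cons_zero h]
  · rw [weight_of_not_adj h, zero_mul]

theorem isClosed_pathSet : IsClosed {x : ℕ → G.DEdge | ∀ n, G.Adj (x n) (x (n + 1))} := by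
  rw [Set.ofPred_forall]
  refine isClosed_iInter fun n => ?_
  have : Continuous fun x : ℕ → G.DEdge => (x n, x (n + 1)) := by fun_prop
  exact (isClosed_discrete {p : G.DEdge × G.DEdge | G.Adj p.1 p.2}).preimage this

instance compactSpace_path : CompactSpace G.Path :=
  isCompact_iff_compactSpace.mp isClosed_pathSet.isCompact

theorem continuous_coord (n : ℕ) : Continuous fun x : G.Path => x.1 n :=
  (continuous_apply n).comp continuous_subtype_val

theorem continuous_shift : Continuous (shift : G.Path → G.Path) := by
  unfold shift
  exact Continuous.subtype_mk (continuous_pi fun n => continuous_coord (n + 1)) _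

/-- A function of one coordinate is continuous. -/
theorem continuous_comp_coord {α : Type*} [TopologicalSpace α] (F : G.DEdge → α) (n : ℕ) :
    Continuous fun x : G.Path => F (x.1 n) :=
  continuous_of_discreteTopology.comp (continuous_coord n)

theorem isClopen_head (s : Set G.DEdge) : IsClopen {x : G.Path | x.1 0 ∈ s} :=
  (isClopen_discrete s).preimage (continuous_coord 0)

theorem continuous_cons (e : G.DEdge) : Continuous (cons e) := by
  refine Continuous.subtype_mk (f := fun x => (cons e x).1) (continuous_pi fun n => ?_) _
  -- Each coordinate of `cons e x` depends on three coordinates of `x` only. At `n = 0` the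
  -- truncated index `n - 1` is harmless, as that coordinate is not used.
  have h : (fun x : G.Path => (cons e x).1 n) =
      (fun p : G.DEdge × G.DEdge × G.DEdge => if G.Adj e p.1 then
        (Nat.casesOn n e fun _ => p.2.1 : G.DEdge) else p.2.2) ∘
      fun x => (x.1 0, x.1 (n - 1), x.1 n) := by
    funext x
    by_cases hx : G.Adj e (x.1 0)
    · cases n <;> simp [cons, hx]
    · simp [cons, hx]
  rw [h]
  exact continuous_of_discreteTopology.comp ((continuous_coord 0).prodMk
    ((continuous_coord (n - 1)).prodMk (continuous_coord n)))

theorem integrable_of_continuous {φ : G.Path → ℝ} (hφ : Continuous φ) (m : Measure G.Path)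
    [IsFiniteMeasure m] : Integrable φ m :=
  hφ.integrable_of_hasCompactSupport (HasCompactSupport.of_compactSpace φ)

/-- Any two directed edges are joined by a non-backtracking path. -/
def Irreducible (G : FinGraph) : Prop := ∀ e e' : G.DEdge, Relation.ReflTransGen G.Adj e e'

end FinGraph

/-- Equality case of the minimum principle: an average that equals the minimum sees only the
minimum. It drives both rigidity statements, for harmonic functions and for stationary vectors. -/
theorem eq_of_weighted_average_eq {ι : Type*} [Fintype ι] {q a : ι → ℝ} {c : ℝ}
    (hq : ∀ i, 0 ≤ q i) (h1 : ∑ i, q i = 1) (ha : ∀ i, c ≤ a i) (hc : ∑ i, q i * a i = c)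
    {i : ι} (hi : 0 < q i) : a i = c := by
  have h0 : ∑ i, q i * (a i - c) = 0 := by
    simp only [mul_sub, Finset.sum_sub_distrib, ← Finset.sum_mul, h1, hc]; ring
  have h2 := (Finset.sum_eq_zero_iff_of_nonneg
    (fun i _ => mul_nonneg (hq i) (sub_nonneg.2 (ha i)))).1 h0 i (Finset.mem_univ i)
  have := (mul_eq_zero.1 h2).resolve_left hi.ne'
  linarith

/-! ### Perron eigenvectors and rigidity by the minimum principle -/

namespace FinGraph

variable {G : FinGraph}

/-- Positive left and right eigenvectors of the weighted adjacency matrix, for the eigenvalue one. -/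
structure Perron (l : G.EdgeFun) where
  left : G.DEdge → ℝ
  right : G.DEdge → ℝ
  left_pos : ∀ e, 0 < left e
  right_pos : ∀ e, 0 < right e
  left_eq : ∀ e', ∑ e, weight l e e' * left e = left e'
  right_eq : ∀ e, ∑ e', weight l e e' * right e' = right e

variable {l : G.EdgeFun} (P : Perron l)

/-- Transition probabilities of the time-reversed Markov chain. -/
def Perron.backward (e' e : G.DEdge) : ℝ := weight l e e' * P.left e / P.left e'

theorem Perron.backward_nonneg (e' e : G.DEdge) : 0 ≤ P.backward e' e :=
  div_nonneg (mul_nonneg (weight_nonneg l e e') (P.left_pos e).le) (P.left_pos e').le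

theorem Perron.backward_pos {e' e : G.DEdge} (h : G.Adj e e') : 0 < P.backward e' e :=
  div_pos (mul_pos (weight_pos h) (P.left_pos e)) (P.left_pos e')

theorem Perron.backward_of_not_adj {e' e : G.DEdge} (h : ¬ G.Adj e e') : P.backward e' e = 0 := by
  simp [Perron.backward, weight_of_not_adj h]

theorem Perron.sum_backward (e' : G.DEdge) : ∑ e, P.backward e' e = 1 := by
  simp only [Perron.backward, ← Finset.sum_div, P.left_eq, div_self (P.left_pos e').ne']

/-- The normalized transfer operator. -/
def Perron.average (φ : G.Path → ℝ) (x : G.Path) : ℝ := ∑ e, P.backward (x.1 0) e * φ (cons e x)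

/-- Conjugating by the left eigenvector turns the transfer operator into a Markov averaging
operator, so that eigenfunctions become harmonic functions. -/
theorem Perron.transfer_eq_average (φ : G.Path → ℝ) (x : G.Path) :
    transfer (fun y => - onPath l y) (fun y => φ y * P.left (y.1 0)) x =
      P.left (x.1 0) * P.average φ x := by
  rw [transfer_eq_sum, Perron.average, Finset.mul_sum]
  refine Finset.sum_congr rfl fun e _ => ?_
  by_cases h : G.Adj e (x.1 0)
  · have := (P.left_pos (x.1 0)).ne'
    rw [cons_zero h, Perron.backward]
    field_simp
  · simp [weight_of_not_adj h, P.backward_of_not_adj h]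

/-- By compactness the minimum is attained, and a minimiser passes the minimum on to all its
preimages. By irreducibility these iterated preimages are dense, and continuity finishes. -/
theorem Perron.harmonic_eq_const (hG : G.Irreducible) {g : G.Path → ℝ}
    (hg : Continuous g) (h : ∀ x, P.average g x = g x) : ∃ c, ∀ x, g x = c := by
  rcases isEmpty_or_nonempty G.Path with hE | hE
  · exact ⟨0, fun x => (hE.false x).elim⟩
  obtain ⟨x₀, -, hx₀⟩ := isCompact_univ.exists_isMinOn (Set.univ_nonempty (α := G.Path))
    hg.continuousOn
  have hmin : ∀ x, g x₀ ≤ g x := fun x => hx₀ (Set.mem_univ x)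
  have hcons : ∀ x e, G.Adj e (x.1 0) → g x = g x₀ → g (cons e x) = g x₀ := fun x e he hx =>
    eq_of_weighted_average_eq (P.backward_nonneg (x.1 0)) (P.sum_backward (x.1 0))
      (fun e => hmin (cons e x)) ((h x).trans hx) (P.backward_pos he)
  have hhead : ∀ e, ∃ x : G.Path, g x = g x₀ ∧ x.1 0 = e := by
    intro e
    induction hG e (x₀.1 0) using Relation.ReflTransGen.head_induction_on with
    | refl => exact ⟨x₀, rfl, rfl⟩
    | head hab _ ih =>
      obtain ⟨x, hx, rfl⟩ := ih
      exact ⟨cons _ x, hcons x _ hab hx, cons_zero hab⟩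
  -- Density: some minimiser agrees with `y` up to time `n`. It comes from a minimiser agreeing with
  -- `shift y` by prepending the first edge of `y`.
  have hword : ∀ (n : ℕ) (y : G.Path), ∃ x : G.Path, g x = g x₀ ∧ ∀ i ≤ n, x.1 i = y.1 i := by
    intro n
    induction n with
    | zero =>
      intro y
      obtain ⟨x, hx, hy⟩ := hhead (y.1 0)
      exact ⟨x, hx, fun i hi => by rw [Nat.le_zero.1 hi, hy]⟩
    | succ n ih =>
      intro y
      obtain ⟨x, hx, hy⟩ := ih (shift y)
      have hadj : G.Adj (y.1 0) (x.1 0) := by rw [hy 0 (Nat.zero_le n)]; exact y.2 0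
      refine ⟨cons (y.1 0) x, hcons x _ hadj hx, fun i hi => ?_⟩
      cases i with
      | zero => exact cons_zero hadj
      | succ i => rw [cons_succ hadj]; exact hy i (by omega)
  refine ⟨g x₀, fun y => ?_⟩
  choose z hz hzy using fun n => hword n y
  have hlim : Tendsto z atTop (𝓝 y) := by
    rw [tendsto_subtype_rng, tendsto_pi_nhds]
    intro i
    refine tendsto_const_nhds.congr' ?_
    filter_upwards [eventually_ge_atTop i] with n hn using (hzy n i hn).symm
  refine tendsto_nhds_unique ((hg.tendsto y).comp hlim) ?_
  simp only [Function.comp_def, hz]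
  exact tendsto_const_nhds

theorem Perron.eigenfunction_eq (hG : G.Irreducible) {v : G.Path → ℝ}
    (hv : Continuous v) (h : ∀ x, transfer (fun y => - onPath l y) v x = v x) :
    ∃ c, ∀ x, v x = c * P.left (x.1 0) := by
  have hne : ∀ x : G.Path, P.left (x.1 0) ≠ 0 := fun x => (P.left_pos _).ne'
  obtain ⟨c, hc⟩ := P.harmonic_eq_const hG
    (g := fun x => v x / P.left (x.1 0)) (hv.div (continuous_comp_coord P.left 0) hne) (by
      intro x
      have := P.transfer_eq_average (fun x => v x / P.left (x.1 0)) x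
      simp only [div_mul_cancel₀ _ (hne _)] at this
      rw [eq_div_iff (hne x), mul_comm, ← this]
      exact h x)
  exact ⟨c, fun x => (div_eq_iff (hne x)).1 (hc x)⟩

/-- The quotient of `p` by `left * right` is harmonic for the forward chain, with transition
probabilities W(e, e') right(e') / right(e). On a finite irreducible set the minimum principle makes
it constant, with no assumption on the sign of `p`. -/
theorem Perron.stationary_eq (hG : G.Irreducible) {p : G.DEdge → ℝ}
    (h : ∀ e, ∑ e', p e' * P.backward e' e = p e) : ∃ c, ∀ e, p e = c * (P.left e * P.right e) := by
  rcases isEmpty_or_nonempty G.DEdge with hE | hE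
  · exact ⟨0, fun x => (hE.false x).elim⟩
  have hne : ∀ e, P.left e * P.right e ≠ 0 := fun e => (mul_pos (P.left_pos e) (P.right_pos e)).ne'
  obtain ⟨e₀, he₀⟩ := Finite.exists_min fun e => p e / (P.left e * P.right e)
  have hmin : ∀ e, p e / (P.left e * P.right e) = p e₀ / (P.left e₀ * P.right e₀) := by
    intro e
    induction hG e₀ e with
    | refl => rfl
    | @tail b c _ hbc ih =>
      rw [← ih]
      refine eq_of_weighted_average_eq (q := fun e' => weight l b e' * P.right e' / P.right b)
        (a := fun e => p e / (P.left e * P.right e)) (fun e' => div_nonneg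
          (mul_nonneg (weight_nonneg l b e') (P.right_pos e').le) (P.right_pos b).le) ?_
        (fun e => (he₀ e).trans' ih.le) ?_ (div_pos (mul_pos (weight_pos hbc) (P.right_pos c))
          (P.right_pos b))
      · rw [← Finset.sum_div, P.right_eq, div_self (P.right_pos b).ne']
      · rw [← h b, Finset.sum_div]
        refine Finset.sum_congr rfl fun e' _ => ?_
        have h1 := (P.left_pos e').ne'
        have h2 := (P.right_pos e').ne'
        have h3 := (P.left_pos b).ne'
        have h4 := (P.right_pos b).ne'
        rw [Perron.backward]
        field_simp
  exact ⟨p e₀ / (P.left e₀ * P.right e₀), fun e => (div_eq_iff (hne e)).1 (hmin e)⟩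

end FinGraph

/-! ### Cylinders and uniqueness of the equilibrium state -/

namespace FinGraph

variable {G : FinGraph}

/-- The paths whose first `n` edges are those of the sequence `y`. -/
def cyl (n : ℕ) (y : ℕ → G.DEdge) : Set G.Path := {x | ∀ i < n, x.1 i = y i}

theorem cyl_zero (y : ℕ → G.DEdge) : cyl 0 y = Set.univ := by ext; simp [cyl]

theorem isClopen_cyl (n : ℕ) (y : ℕ → G.DEdge) : IsClopen (cyl n y) := by
  have : cyl n y = ⋂ i ∈ Finset.range n, (fun x : G.Path => x.1 i) ⁻¹' {y i} := by
    ext x; simp [cyl]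
  rw [this]
  exact isClopen_biInter_finset fun i _ => (isClopen_discrete _).preimage (continuous_coord i)

/-- Two cylinders are either disjoint or nested. -/
theorem isPiSystem_cyl : IsPiSystem {s : Set G.Path | ∃ n y, s = cyl n y} := by
  have key : ∀ {n m : ℕ} (y z : ℕ → G.DEdge), n ≤ m → (cyl n y ∩ cyl m z).Nonempty →
      cyl n y ∩ cyl m z = cyl m z := by
    rintro n m y z hnm ⟨x, hx, hx'⟩
    refine Set.inter_eq_right.2 fun w hw i hi => ?_
    rw [hw i (hi.trans_le hnm), ← hx i hi, hx' i (hi.trans_le hnm)]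
  rintro _ ⟨n, y, rfl⟩ _ ⟨m, z, rfl⟩ hne
  rcases le_total n m with h | h
  · exact ⟨m, z, key y z h hne⟩
  · rw [Set.inter_comm] at hne ⊢
    exact ⟨n, y, key z y h hne⟩

theorem generateFrom_cyl : (inferInstance : MeasurableSpace G.Path) =
    MeasurableSpace.generateFrom {s : Set G.Path | ∃ n y, s = cyl n y} := by
  apply le_antisymm
  · have hval : @Measurable _ _ (MeasurableSpace.generateFrom
        {s : Set G.Path | ∃ n y, s = cyl n y}) _ (Subtype.val : G.Path → ℕ → G.DEdge) := by
      refine @measurable_pi_lambda _ _ _ (MeasurableSpace.generateFrom _) _ _ fun i => ?_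
      refine @measurable_to_countable' _ _ _ _ (MeasurableSpace.generateFrom _) _ fun e => ?_
      -- The `i`-th edge is `e` exactly on the finite union of the cylinders of words of length `i +
      -- 1` ending in `e`.
      have hU : (fun x : G.Path => x.1 i) ⁻¹' {e} =
          ⋃ w : {w : Fin (i + 1) → G.DEdge // w (Fin.last i) = e},
            cyl (i + 1) fun j => if h : j < i + 1 then w.1 ⟨j, h⟩ else e := by
        ext x
        simp only [Set.mem_preimage, Set.mem_singleton_iff, Set.mem_iUnion]
        constructor
        · rintro rfl
          exact ⟨⟨fun j => x.1 j, rfl⟩, fun j hj => by simp [hj]⟩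
        · rintro ⟨w, hw⟩
          have := hw i (Nat.lt_succ_self i)
          simp only [Nat.lt_succ_self, dite_true] at this
          exact this.trans w.2
      rw [hU]
      exact @MeasurableSet.iUnion _ _ (MeasurableSpace.generateFrom _) _ _ fun w =>
        MeasurableSpace.measurableSet_generateFrom ⟨_, _, rfl⟩
    exact hval.comap_le
  · refine MeasurableSpace.generateFrom_le ?_
    rintro _ ⟨n, y, rfl⟩
    exact (isClopen_cyl n y).1.measurableSet

theorem measure_ext_of_cyl {μ ν : Measure G.Path} [IsFiniteMeasure μ]
    (h : ∀ n y, μ (cyl n y) = ν (cyl n y)) : μ = ν := by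
  rcases isEmpty_or_nonempty G.Path with hE | ⟨⟨x⟩⟩
  · exact Measure.ext fun s _ => by rw [Set.eq_empty_of_isEmpty s, measure_empty, measure_empty]
  refine ext_of_generate_finite _ generateFrom_cyl isPiSystem_cyl ?_ ?_
  · rintro _ ⟨n, y, rfl⟩
    exact h n y
  · simpa only [cyl_zero] using h 0 x.1

theorem sum_measure_head (μ : Measure G.Path) (s : Finset G.DEdge) :
    μ {x | x.1 0 ∈ s} = ∑ e ∈ s, μ (cyl 1 fun _ => e) := by
  have h : ∀ e : G.DEdge, (cyl 1 fun _ => e) = (fun x : G.Path => x.1 0) ⁻¹' {e} := by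
    intro e; ext; simp [cyl]
  simp only [h]
  exact (sum_measure_preimage_singleton s fun e _ =>
    ((isClopen_discrete {e}).preimage (continuous_coord 0)).1.measurableSet).symm

/-- The whole space is the union of the cylinders of length one, so nonempty words suffice. Explicit
formulas for cylinders are available for these only. -/
theorem measure_ext_of_cyl_succ {μ ν : Measure G.Path} [IsFiniteMeasure μ]
    (h : ∀ n y, μ (cyl (n + 1) y) = ν (cyl (n + 1) y)) : μ = ν := by
  refine measure_ext_of_cyl fun n y => ?_
  cases n with
  | zero =>
    have hU : cyl 0 y = {x | x.1 0 ∈ (Finset.univ : Finset G.DEdge)} := by ext; simp [cyl]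
    simp only [hU, sum_measure_head, h 0]
  | succ n => exact h n y

variable {l : G.EdgeFun} (P : Perron l)

/-- `m` is a probability measure fixed by the dual of the normalized transfer operator. -/
structure Perron.IsInvariant (m : Measure G.Path) : Prop where
  prob : IsProbabilityMeasure m
  integral_average : ∀ φ : G.Path → ℝ, Continuous φ → ∫ x, P.average φ x ∂m = ∫ x, φ x ∂m

theorem integral_equilibrium {v : G.Path → ℝ} {μ : Measure G.Path}
    (hv : Continuous v) (hpos : ∀ x, 0 < v x) (hi : 0 ≤ ∫ x, v x ∂μ) (φ : G.Path → ℝ) :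
    ∫ x, φ x ∂((ENNReal.ofReal (∫ x, v x ∂μ))⁻¹ •
      μ.withDensity (fun x => ENNReal.ofReal (v x))) = (∫ x, v x ∂μ)⁻¹ * ∫ x, φ x * v x ∂μ := by
  rw [integral_smul_measure, ENNReal.toReal_inv, ENNReal.toReal_ofReal hi, smul_eq_mul]
  congr 1
  have : (fun x => ENNReal.ofReal (v x)) = fun x => ((Real.toNNReal (v x) : NNReal) : ENNReal) :=
    rfl
  rw [this, integral_withDensity_eq_integral_smul (hv.measurable.real_toNNReal)]
  refine integral_congr_ae (Eventually.of_forall fun x => ?_)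
  simp only [NNReal.smul_def, Real.coe_toNNReal _ (hpos x).le, smul_eq_mul, mul_comm]

theorem integral_pos_of_continuous {v : G.Path → ℝ} {μ : Measure G.Path} [IsProbabilityMeasure μ]
    (hv : Continuous v) (hpos : ∀ x, 0 < v x) : 0 < ∫ x, v x ∂μ := by
  rw [integral_pos_iff_support_of_nonneg (fun x => (hpos x).le) (integrable_of_continuous hv μ)]
  have : Function.support v = Set.univ := by
    ext x; simp [(hpos x).ne']
  rw [this, measure_univ]
  exact one_pos

/-- Any admissible eigenfunction `v` is a multiple of the left eigenvector. Multiplication by `v`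
therefore conjugates the transfer operator to `average`, and the duality for `μ` becomes invariance
of the normalised measure `v μ`. -/
theorem Perron.isInvariant_of_isEquilibriumState (hG : G.Irreducible) {m : Measure G.Path}
    (hm : IsEquilibriumState (fun x => - onPath l x) m) : P.IsInvariant m := by
  obtain ⟨v, μ, hv, hpos, hev, hμ, hdual, rfl⟩ := hm
  have hi := integral_pos_of_continuous (μ := μ) hv hpos
  obtain ⟨c, hc⟩ := P.eigenfunction_eq hG hv hev
  refine ⟨⟨?_⟩, fun φ hφ => ?_⟩
  · rw [Measure.smul_apply, withDensity_apply _ MeasurableSet.univ, Measure.restrict_univ,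
      ← ofReal_integral_eq_lintegral_ofReal (integrable_of_continuous hv μ)
        (Eventually.of_forall fun x => (hpos x).le), smul_eq_mul]
    exact ENNReal.inv_mul_cancel (by simpa using hi) ENNReal.ofReal_ne_top
  · rw [integral_equilibrium hv hpos hi.le, integral_equilibrium hv hpos hi.le]
    congr 1
    have h1 : ∀ x, P.average φ x * v x =
        transfer (fun y => - onPath l y) (fun y => φ y * v y) x := by
      intro x
      have : (fun y => φ y * v y) = fun y => c * φ y * P.left (y.1 0) := by
        funext y; rw [hc]; ring
      rw [this, P.transfer_eq_average (fun y => c * φ y), hc, Perron.average, Perron.average,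
        Finset.sum_mul, Finset.mul_sum]
      exact Finset.sum_congr rfl fun e _ => by ring
    simp only [h1]
    exact hdual _ (hφ.mul hv)

theorem Perron.average_eq {φ : G.Path → ℝ} {x : G.Path} {F : G.DEdge → ℝ}
    (h : ∀ e, G.Adj e (x.1 0) → φ (cons e x) = F e) :
    P.average φ x = ∑ e, P.backward (x.1 0) e * F e := by
  refine Finset.sum_congr rfl fun e _ => ?_
  by_cases he : G.Adj e (x.1 0)
  · rw [h e he]
  · rw [P.backward_of_not_adj he, zero_mul, zero_mul]

theorem continuous_indicator_one {s : Set G.Path} (hs : IsClopen s) :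
    Continuous (s.indicator fun _ => (1 : ℝ)) :=
  continuous_indicator (by simp [hs.frontier_eq]) continuousOn_const

variable {P}

theorem integral_indicator_one {m : Measure G.Path} {s : Set G.Path}
    (hs : IsClopen s) : ∫ x, s.indicator (fun _ => (1 : ℝ)) x ∂m = m.real s := by
  rw [integral_indicator hs.1.measurableSet]; simp

/-- The probability of the first edge. -/
def headProb (m : Measure G.Path) (e : G.DEdge) : ℝ := m.real {x | x.1 0 = e}

theorem isClopen_head_eq (e : G.DEdge) : IsClopen {x : G.Path | x.1 0 = e} :=
  isClopen_head {e}

theorem integral_comp_head (m : Measure G.Path) [IsFiniteMeasure m] (F : G.DEdge → ℝ) :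
    ∫ x, F (x.1 0) ∂m = ∑ e, headProb m e * F e := by
  have h : ∀ x : G.Path, F (x.1 0) = ∑ e, {x : G.Path | x.1 0 = e}.indicator (fun _ => F e) x := by
    intro x
    simp [Set.indicator_apply]
  simp only [h]
  rw [integral_finsetSum _ fun e _ => (integrable_const _).indicator
    (isClopen_head_eq e).1.measurableSet]
  refine Finset.sum_congr rfl fun e _ => ?_
  rw [MeasureTheory.integral_indicator (isClopen_head_eq e).1.measurableSet]
  simp [headProb]

theorem Perron.IsInvariant.headProb_stationary {m : Measure G.Path} (hm : P.IsInvariant m)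
    (e : G.DEdge) : ∑ e', headProb m e' * P.backward e' e = headProb m e := by
  have := hm.prob
  rw [← integral_comp_head m fun e' => P.backward e' e, headProb,
    ← integral_indicator_one (isClopen_head_eq e),
    ← hm.integral_average _ (continuous_indicator_one (isClopen_head_eq e))]
  refine integral_congr_ae (Eventually.of_forall fun x => ?_)
  simp only
  rw [P.average_eq (F := fun e' => if e' = e then 1 else 0)
    fun e' he' => by simp [Set.indicator_apply, cons_zero he']]
  simp

theorem Perron.IsInvariant.headProb_eq (hG : G.Irreducible) {m : Measure G.Path}
    (hm : P.IsInvariant m) (e : G.DEdge) :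
    headProb m e = P.left e * P.right e / ∑ e, P.left e * P.right e := by
  have := hm.prob
  obtain ⟨c, hc⟩ := P.stationary_eq hG hm.headProb_stationary
  have h1 : ∑ e, headProb m e = 1 := by
    have := integral_comp_head m fun _ => 1
    simpa using this.symm
  simp only [hc, ← Finset.mul_sum] at h1
  rw [hc, div_eq_mul_inv, mul_comm, ← eq_inv_of_mul_eq_one_left h1]

/-- Averaging the indicator of a cylinder over the first edge leaves a transition probability times
the indicator of the shifted cylinder. With `headProb_eq` as the initial value, this recursion
determines the measure. -/
theorem Perron.IsInvariant.measure_cyl_succ {m : Measure G.Path} (hm : P.IsInvariant m)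
    (n : ℕ) (y : ℕ → G.DEdge) : m.real (cyl (n + 2) y) =
      P.backward (y 1) (y 0) * m.real (cyl (n + 1) fun i => y (i + 1)) := by
  rw [← integral_indicator_one (isClopen_cyl _ _), ← integral_indicator_one (isClopen_cyl _ _),
    ← integral_const_mul,
    ← hm.integral_average _ (continuous_indicator_one (isClopen_cyl _ _))]
  refine integral_congr_ae (Eventually.of_forall fun x => ?_)
  simp only
  have hmem : ∀ e, G.Adj e (x.1 0) → (cons e x ∈ cyl (n + 2) y ↔
      e = y 0 ∧ x ∈ cyl (n + 1) fun i => y (i + 1)) := by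
    intro e he
    constructor
    · intro h
      refine ⟨by rw [← h 0 (by omega), cons_zero he], fun i hi => ?_⟩
      exact (cons_succ he i).symm.trans (h (i + 1) (by omega))
    · rintro ⟨rfl, h⟩ i hi
      cases i with
      | zero => exact cons_zero he
      | succ i => rw [cons_succ he]; exact h i (by omega)
  by_cases hx : x ∈ cyl (n + 1) fun i => y (i + 1)
  · have hx0 : x.1 0 = y 1 := hx 0 (by omega)
    rw [P.average_eq (F := fun e' => if e' = y 0 then 1 else 0)
      fun e' he' => by
        by_cases h : e' = y 0
        · rw [Set.indicator_of_mem ((hmem e' he').2 ⟨h, hx⟩), if_pos h]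
        · rw [Set.indicator_of_notMem fun h' => h ((hmem e' he').1 h').1, if_neg h]]
    simp [hx, hx0]
  · rw [P.average_eq (F := fun _ => 0) fun e' he' => by simp [hmem e' he', hx]]
    simp [hx]

theorem Perron.IsInvariant.unique (hG : G.Irreducible) {m m' : Measure G.Path}
    (hm : P.IsInvariant m) (hm' : P.IsInvariant m') : m = m' := by
  have := hm.prob
  have := hm'.prob
  refine measure_ext_of_cyl fun n y => ?_
  rw [← measureReal_eq_measureReal_iff]
  induction n generalizing y with
  | zero => simp [cyl_zero]
  | succ n ih =>
    cases n with
    | zero =>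
      have : cyl (0 + 1) y = {x | x.1 0 = y 0} := by ext; simp [cyl]
      rw [this]
      exact (hm.headProb_eq hG (y 0)).trans (hm'.headProb_eq hG (y 0)).symm
    | succ n => rw [hm.measure_cyl_succ, hm'.measure_cyl_succ, ih]

end FinGraph

/-! ### The eigenmeasure as a Markov measure, and existence -/

namespace FinGraph

variable {G : FinGraph} {l : G.EdgeFun} (P : Perron l)

/-- Transition probabilities of the Markov chain of the eigenmeasure. -/
def Perron.forward (e e' : G.DEdge) : ℝ := weight l e e' * P.right e' / P.right e

theorem Perron.forward_nonneg (e e' : G.DEdge) : 0 ≤ P.forward e e' :=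
  div_nonneg (mul_nonneg (weight_nonneg l e e') (P.right_pos e').le) (P.right_pos e).le

theorem Perron.sum_forward (e : G.DEdge) : ∑ e', P.forward e e' = 1 := by
  simp only [Perron.forward, ← Finset.sum_div, P.right_eq, div_self (P.right_pos e).ne']

/-- The law of the edge that follows `e`. -/
def Perron.stepLaw (e : G.DEdge) : Measure {e' // G.Adj e e'} :=
  ∑ e' : {e' // G.Adj e e'}, ENNReal.ofReal (P.forward e e'.1) • Measure.dirac e'

theorem Perron.stepLaw_apply (e : G.DEdge) (s : Set {e' // G.Adj e e'}) [DecidablePred (· ∈ s)] :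
    P.stepLaw e s = ∑ e', if e' ∈ s then ENNReal.ofReal (P.forward e e'.1) else 0 := by
  simp [Perron.stepLaw, Set.indicator_apply]

instance Perron.isProbabilityMeasure_stepLaw (e : G.DEdge) :
    IsProbabilityMeasure (P.stepLaw e) := by
  refine ⟨?_⟩
  rw [P.stepLaw_apply e Set.univ]
  simp only [Set.mem_univ, if_true]
  rw [← ENNReal.ofReal_sum_of_nonneg fun _ _ => P.forward_nonneg _ _, ← ENNReal.ofReal_one,
    ← P.sum_forward e]
  congr 1
  rw [← Finset.sum_filter_of_ne (p := G.Adj e)]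
  · exact (Finset.sum_subtype _ (by simp) _).symm
  · intro e' _ h
    by_contra h'
    simp [Perron.forward, weight_of_not_adj h'] at h

theorem Perron.stepLaw_val_eq (e e₁ : G.DEdge) :
    P.stepLaw e {z | z.1 = e₁} = ENNReal.ofReal (P.forward e e₁) := by
  rw [P.stepLaw_apply]
  by_cases h : G.Adj e e₁
  · rw [Finset.sum_eq_single ⟨e₁, h⟩]
    · simp
    · intro b _ hb
      rw [if_neg]
      rintro rfl
      exact hb rfl
    · simp
  · rw [Finset.sum_eq_zero, Perron.forward, weight_of_not_adj h]
    · simp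
    · intro b _
      rw [if_neg]
      rintro rfl
      exact h b.2

/-- The edges visited when the edge taken at time `n` after `e` is `ω (n, e)`. -/
def walk (ω : ∀ i : ℕ × G.DEdge, {e' // G.Adj i.2 e'}) (e : G.DEdge) : ℕ → G.DEdge
  | 0 => e
  | n + 1 => (ω (n, walk ω e n)).1

/-- The walk as a path. -/
def walkPath (e : G.DEdge) (ω : ∀ i : ℕ × G.DEdge, {e' // G.Adj i.2 e'}) : G.Path :=
  ⟨walk ω e, fun n => (ω (n, walk ω e n)).2⟩

/-- The Markov measure started at `e`. -/
def Perron.markov (e : G.DEdge) : Measure G.Path :=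
  (Measure.infinitePi fun i : ℕ × G.DEdge => P.stepLaw i.2).map (walkPath e)

/-- An independent choice is made for every pair (time, edge), so following `y` for `n` steps
constrains the coordinates `(i, y i)`, `i < n`, and no others. These indices are distinct because
the times are, and the product measure gives the product of the transition probabilities. -/
theorem walkPath_preimage (e : G.DEdge) (n : ℕ) (y : ℕ → G.DEdge) (h : y 0 = e) :
    walkPath e ⁻¹' cyl (n + 1) y = Set.pi ((Finset.range n).image fun i => (i, y i) : Finset _)
      fun i => {z | z.1 = y (i.1 + 1)} := by
  ext ω
  simp only [Set.mem_preimage, Set.mem_pi, Finset.coe_image, Set.mem_image, Finset.coe_range,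
    Set.mem_Iio, forall_exists_index, and_imp, forall_apply_eq_imp_iff₂]
  constructor
  · intro hω i hi
    have h1 : walk ω e i = y i := hω i (by omega)
    have h2 : walk ω e (i + 1) = y (i + 1) := hω (i + 1) (by omega)
    rw [walk, h1] at h2
    exact h2
  · intro hω i hi
    change walk ω e i = y i
    induction i with
    | zero => exact h.symm
    | succ i ih =>
      rw [walk, ih (by omega)]
      exact hω i (by omega)

theorem walkPath_preimage_of_ne (e : G.DEdge) (n : ℕ) (y : ℕ → G.DEdge) (h : y 0 ≠ e) :
    walkPath e ⁻¹' cyl (n + 1) y = ∅ := by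
  ext ω
  simp only [Set.mem_preimage, Set.mem_empty_iff_false, iff_false]
  intro hω
  exact h (hω 0 (by omega)).symm

theorem measurable_walkPath (e : G.DEdge) : Measurable (walkPath e) := by
  refine (measurable_generateFrom ?_).mono le_rfl generateFrom_cyl.le
  rintro _ ⟨n, y, rfl⟩
  cases n with
  | zero => simp [cyl_zero]
  | succ n =>
    by_cases h : y 0 = e
    · rw [walkPath_preimage e n y h]
      exact MeasurableSet.pi (Finset.countable_toSet _) fun i _ => MeasurableSet.of_discrete
    · rw [walkPath_preimage_of_ne e n y h]
      exact MeasurableSet.empty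

instance Perron.isProbabilityMeasure_markov (e : G.DEdge) : IsProbabilityMeasure (P.markov e) :=
  Measure.isProbabilityMeasure_map (measurable_walkPath e).aemeasurable

theorem Perron.markov_cyl (e : G.DEdge) (n : ℕ) (y : ℕ → G.DEdge) :
    P.markov e (cyl (n + 1) y) = if y 0 = e then
      ENNReal.ofReal (∏ i ∈ Finset.range n, P.forward (y i) (y (i + 1))) else 0 := by
  rw [Perron.markov, Measure.map_apply (measurable_walkPath e) (isClopen_cyl _ _).1.measurableSet]
  split_ifs with h
  · rw [walkPath_preimage e n y h, Measure.infinitePi_pi _ fun i _ => MeasurableSet.of_discrete,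
      Finset.prod_image fun i _ j _ hij => congrArg Prod.fst hij,
      ENNReal.ofReal_prod_of_nonneg fun i _ => P.forward_nonneg _ _]
    exact Finset.prod_congr rfl fun i _ => P.stepLaw_val_eq _ _
  · rw [walkPath_preimage_of_ne e n y h, measure_empty]

/-- The mixture of the Markov measures with weights given by the right eigenvector. -/
def Perron.rightMeasure : Measure G.Path := ∑ e, ENNReal.ofReal (P.right e) • P.markov e

instance Perron.isFiniteMeasure_rightMeasure : IsFiniteMeasure P.rightMeasure := by
  refine ⟨?_⟩
  simp only [Perron.rightMeasure, Measure.finsetSum_apply, Measure.smul_apply, measure_univ,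
    smul_eq_mul, mul_one]
  exact ENNReal.sum_lt_top.2 fun e _ => ENNReal.ofReal_lt_top

theorem Perron.rightMeasure_univ : P.rightMeasure Set.univ = ENNReal.ofReal (∑ e, P.right e) := by
  simp [Perron.rightMeasure, ENNReal.ofReal_sum_of_nonneg fun e _ => (P.right_pos e).le]

theorem Perron.rightMeasure_cyl (n : ℕ) (y : ℕ → G.DEdge) :
    P.rightMeasure (cyl (n + 1) y) = ENNReal.ofReal
      (P.right (y 0) * ∏ i ∈ Finset.range n, P.forward (y i) (y (i + 1))) := by
  simp [Perron.rightMeasure, P.markov_cyl, ENNReal.ofReal_mul (P.right_pos _).le]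

/-- The image of a measure under the dual of the transfer operator. -/
def dualTransfer (l : G.EdgeFun) (μ : Measure G.Path) : Measure G.Path :=
  ∑ e, ENNReal.ofReal (Real.exp (-l e.1)) •
    (μ.restrict {x : G.Path | G.Adj e (x.1 0)}).map (cons e)

theorem isClopen_adj (e : G.DEdge) : IsClopen {x : G.Path | G.Adj e (x.1 0)} :=
  isClopen_head {e' | G.Adj e e'}

theorem integral_dualTransfer (l : G.EdgeFun) (μ : Measure G.Path) [IsFiniteMeasure μ]
    {φ : G.Path → ℝ} (hφ : Continuous φ) :
    ∫ x, φ x ∂(dualTransfer l μ) = ∫ x, transfer (fun y => - onPath l y) φ x ∂μ := by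
  simp only [transfer_eq_sum]
  rw [dualTransfer, integral_finsetSum_measure, integral_finsetSum]
  · refine Finset.sum_congr rfl fun e _ => ?_
    rw [integral_smul_measure, integral_map (continuous_cons e).measurable.aemeasurable
      hφ.aestronglyMeasurable, ← integral_indicator (isClopen_adj e).1.measurableSet,
      ENNReal.toReal_ofReal (Real.exp_pos _).le, smul_eq_mul, ← integral_const_mul]
    refine integral_congr_ae (Eventually.of_forall fun x => ?_)
    by_cases h : G.Adj e (x.1 0) <;> simp [weight, h]
  · exact fun e _ => integrable_of_continuous
      ((continuous_comp_coord (fun e' => weight l e e') 0).mul (hφ.comp (continuous_cons e))) μ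
  · intro e _
    exact (integrable_of_continuous hφ _).smul_measure ENNReal.ofReal_ne_top

theorem dualTransfer_apply (l : G.EdgeFun) (μ : Measure G.Path) {s : Set G.Path}
    (hs : MeasurableSet s) : dualTransfer l μ s = ∑ e, ENNReal.ofReal (Real.exp (-l e.1)) *
      μ ({x | G.Adj e (x.1 0) ∧ cons e x ∈ s}) := by
  simp only [dualTransfer, Measure.finsetSum_apply, Measure.smul_apply, smul_eq_mul]
  refine Finset.sum_congr rfl fun e _ => ?_
  rw [Measure.map_apply (continuous_cons e).measurable hs,
    Measure.restrict_apply ((continuous_cons e).measurable hs), Set.inter_comm]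
  rfl

/-- On a cylinder only the edge `y 0` can be prepended. For words of length one the identity is the
right eigenvector equation; for longer words it is right(y₀) · forward(y₀, y₁) = exp(-l(y₀)) ·
right(y₁). -/
theorem Perron.dualTransfer_rightMeasure : dualTransfer l P.rightMeasure = P.rightMeasure := by
  symm
  refine measure_ext_of_cyl_succ fun n y => ?_
  rw [dualTransfer_apply l _ (isClopen_cyl _ _).1.measurableSet, Finset.sum_eq_single (y 0)]
  · cases n with
    | zero =>
      have h0 : {x : G.Path | G.Adj (y 0) (x.1 0) ∧ cons (y 0) x ∈ cyl (0 + 1) y} =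
          {x | x.1 0 ∈ Finset.univ.filter fun e' => G.Adj (y 0) e'} := by
        ext x
        simp only [Set.mem_ofPred_eq, Finset.mem_filter, Finset.mem_univ, true_and]
        refine ⟨fun h => h.1, fun h => ⟨h, fun i hi => ?_⟩⟩
        obtain rfl : i = 0 := by omega
        exact cons_zero h
      rw [h0, sum_measure_head, P.rightMeasure_cyl]
      simp only [P.rightMeasure_cyl 0, Finset.range_zero, Finset.prod_empty, mul_one]
      rw [← ENNReal.ofReal_sum_of_nonneg fun e _ => (P.right_pos e).le,
        ← ENNReal.ofReal_mul (Real.exp_pos _).le, ← P.right_eq (y 0), Finset.sum_filter,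
        Finset.mul_sum]
      simp [weight]
    | succ n =>
      rw [P.rightMeasure_cyl, Finset.prod_range_succ']
      by_cases hy : G.Adj (y 0) (y 1)
      · have h0 : {x : G.Path | G.Adj (y 0) (x.1 0) ∧ cons (y 0) x ∈ cyl (n + 1 + 1) y} =
            cyl (n + 1) fun i => y (i + 1) := by
          ext x
          constructor
          · rintro ⟨h, h'⟩ i hi
            exact (cons_succ h i).symm.trans (h' (i + 1) (by omega))
          · intro h
            have h1 : G.Adj (y 0) (x.1 0) := by rw [h 0 (by omega)]; exact hy
            refine ⟨h1, fun i hi => ?_⟩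
            cases i with
            | zero => exact cons_zero h1
            | succ i => exact (cons_succ h1 i).trans (h i (by omega))
        rw [h0, P.rightMeasure_cyl, ← ENNReal.ofReal_mul (Real.exp_pos _).le]
        congr 1
        have := (P.right_pos (y 0)).ne'
        simp only [zero_add]
        rw [Perron.forward, weight_of_adj hy]
        field_simp
      · have h0 : {x : G.Path | G.Adj (y 0) (x.1 0) ∧ cons (y 0) x ∈ cyl (n + 1 + 1) y} = ∅ := by
          ext x
          simp only [Set.mem_ofPred_eq, Set.mem_empty_iff_false, iff_false]
          rintro ⟨h, h'⟩
          have := (cons_succ h 0).symm.trans (h' 1 (by omega))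
          rw [this] at h
          exact hy h
        rw [h0, measure_empty, zero_add, Perron.forward, weight_of_not_adj hy]
        simp
  · intro e _ he
    have h0 : {x : G.Path | G.Adj e (x.1 0) ∧ cons e x ∈ cyl (n + 1) y} = ∅ := by
      ext x
      simp only [Set.mem_ofPred_eq, Set.mem_empty_iff_false, iff_false]
      rintro ⟨h, h'⟩
      exact he ((cons_zero h).symm.trans (h' 0 (by omega)))
    rw [h0, measure_empty, mul_zero]
  · simp

theorem Perron.exists_isEquilibriumState (P : Perron l) [Nonempty G.DEdge] :
    ∃ m, IsEquilibriumState (fun x => - onPath l x) m := by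
  have hpos : 0 < ∑ e, P.right e := Finset.sum_pos (fun e _ => P.right_pos e) Finset.univ_nonempty
  refine ⟨_, fun x => P.left (x.1 0), (ENNReal.ofReal (∑ e, P.right e))⁻¹ • P.rightMeasure,
    continuous_comp_coord _ _, fun x => P.left_pos _, fun x => ?_, ⟨?_⟩, fun φ hφ => ?_, rfl⟩
  · have := P.transfer_eq_average (fun _ => 1) x
    simpa [Perron.average, P.sum_backward] using this
  · rw [Measure.smul_apply, P.rightMeasure_univ, smul_eq_mul]
    exact ENNReal.inv_mul_cancel (by simpa using hpos) ENNReal.ofReal_ne_top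
  · rw [integral_smul_measure, integral_smul_measure, ← integral_dualTransfer l _ hφ,
      P.dualTransfer_rightMeasure]

theorem Perron.existsUnique_isEquilibriumState (P : Perron l) [Nonempty G.DEdge]
    (hG : G.Irreducible) :
    ∃! m, IsEquilibriumState (fun x => - onPath l x) m := by
  obtain ⟨m, hm⟩ := P.exists_isEquilibriumState
  exact ⟨m, hm, fun m' hm' => (P.isInvariant_of_isEquilibriumState hG hm').unique hG
    (P.isInvariant_of_isEquilibriumState hG hm)⟩

theorem Perron.isInvariant_eqState [Nonempty G.DEdge] (hG : G.Irreducible) :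
    P.IsInvariant (eqState l) := by
  have h := P.exists_isEquilibriumState
  refine P.isInvariant_of_isEquilibriumState hG ?_
  rw [eqState, equilibriumState, dif_pos h]
  exact h.choose_spec

end FinGraph

/-! ### The variance through martingale differences -/

/-- Perturbing a sequence whose second moments grow like `n s` by bounded functions does not change
the growth rate of the second moments. -/
theorem tendsto_second_moment_add_bounded {Ω : Type*} [MeasurableSpace Ω] {m : Measure Ω}
    [IsProbabilityMeasure m] {M D : ℕ → Ω → ℝ} {s K : ℝ}
    (hM : ∀ n, Integrable (fun x => M n x ^ 2) m)
    (hMD : ∀ n, Integrable (fun x => (M n x + D n x) ^ 2) m)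
    (hs : ∀ n, ∫ x, M n x ^ 2 ∂m = n * s) (hD : ∀ n x, |D n x| ≤ K) :
    Tendsto (fun n : ℕ => 1 / (n : ℝ) * ∫ x, (M n x + D n x) ^ 2 ∂m) atTop (𝓝 s) := by
  have hbound : ∀ n : ℕ, 0 < n → |1 / (n : ℝ) * ∫ x, (M n x + D n x) ^ 2 ∂m - s| ≤
      (s + K ^ 2) * (1 / Real.sqrt n) + K ^ 2 * (1 / n) := by
    intro n hn
    have hn' : (0 : ℝ) < n := by exact_mod_cast hn
    have hr : 0 < Real.sqrt n := Real.sqrt_pos.2 hn'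
    have hrr : Real.sqrt n * Real.sqrt n = n := Real.mul_self_sqrt hn'.le
    have hpt : ∀ x, |(M n x + D n x) ^ 2 - M n x ^ 2| ≤
        1 / Real.sqrt n * M n x ^ 2 + (Real.sqrt n + 1) * K ^ 2 := by
      intro x
      have h1 : (M n x + D n x) ^ 2 - M n x ^ 2 = 2 * M n x * D n x + D n x ^ 2 := by ring
      have h2 : D n x ^ 2 ≤ K ^ 2 := by
        rw [← sq_abs]; exact pow_le_pow_left₀ (abs_nonneg _) (hD n x) 2
      -- The inequality 2|MD| ≤ M²/r + rD² with r = √n balances the errors: after division by n both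
      -- are of order 1/√n.
      have h3 : |2 * M n x * D n x| ≤ 1 / Real.sqrt n * M n x ^ 2 + Real.sqrt n * D n x ^ 2 := by
        have e : 1 / Real.sqrt n * M n x ^ 2 + Real.sqrt n * D n x ^ 2 =
          (M n x ^ 2 + n * D n x ^ 2) / Real.sqrt n := by
            field_simp; rw [sq (Real.sqrt n), hrr, mul_comm (n : ℝ)]
        rw [e, le_div_iff₀ hr]
        have h4 : |2 * M n x * D n x| * Real.sqrt n = |2 * M n x * D n x * Real.sqrt n| := by
          rw [abs_mul _ (Real.sqrt n), abs_of_pos hr]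
        rw [h4, abs_le]
        constructor
        · nlinarith [sq_nonneg (M n x + Real.sqrt n * D n x), congrArg (· * D n x ^ 2) hrr]
        · nlinarith [sq_nonneg (M n x - Real.sqrt n * D n x), congrArg (· * D n x ^ 2) hrr]
      rw [h1]
      refine (abs_add_le _ _).trans ?_
      rw [abs_of_nonneg (sq_nonneg (D n x))]
      nlinarith [mul_le_mul_of_nonneg_left h2 hr.le]
    have hint : |∫ x, (M n x + D n x) ^ 2 ∂m - n * s| ≤
        1 / Real.sqrt n * (n * s) + (Real.sqrt n + 1) * K ^ 2 := by
      rw [← hs n, ← integral_sub (hMD n) (hM n)]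
      refine (abs_integral_le_integral_abs).trans ?_
      have hi := ((hM n).const_mul (1 / Real.sqrt n)).add
        (integrable_const (μ := m) ((Real.sqrt n + 1) * K ^ 2))
      refine (integral_mono ((hMD n).sub (hM n)).abs hi hpt).trans_eq ?_
      simp only [Pi.add_apply]
      rw [integral_add ((hM n).const_mul _) (integrable_const _), integral_const_mul]
      simp
    have h1 : 1 / (n : ℝ) * ∫ x, (M n x + D n x) ^ 2 ∂m - s =
        1 / n * (∫ x, (M n x + D n x) ^ 2 ∂m - n * s) := by field_simp
    rw [h1, abs_mul, abs_of_pos (by positivity)]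
    refine (mul_le_mul_of_nonneg_left hint (by positivity)).trans_eq ?_
    generalize Real.sqrt n = r at *
    rw [← hrr]
    field_simp
    ring
  have hlim : Tendsto (fun n : ℕ => (s + K ^ 2) * (1 / Real.sqrt n) + K ^ 2 * (1 / n)) atTop
      (𝓝 ((s + K ^ 2) * 0 + K ^ 2 * 0)) := by
    refine (Tendsto.const_mul _ ?_).add (tendsto_one_div_atTop_nhds_zero_nat.const_mul _)
    simp only [one_div]
    exact (Real.tendsto_sqrt_atTop.comp tendsto_natCast_atTop_atTop).inv_tendsto_atTop
  rw [mul_zero, mul_zero, add_zero] at hlim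
  rw [tendsto_iff_dist_tendsto_zero]
  refine squeeze_zero' (Eventually.of_forall fun n => dist_nonneg) ?_ hlim
  filter_upwards [eventually_gt_atTop 0] with n hn
  exact hbound n hn

namespace FinGraph

variable {G : FinGraph} {l : G.EdgeFun} {P : Perron l}

/-- `average` acts as the conditional expectation given the shifted path, so functions of that path
factor out. -/
theorem Perron.average_mul_comp_shift (ψ w : G.Path → ℝ) (x : G.Path) :
    P.average (fun y => ψ y * w (shift y)) x = P.average ψ x * w x := by
  rw [Perron.average, Perron.average, Finset.sum_mul]
  refine Finset.sum_congr rfl fun e _ => ?_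
  by_cases h : G.Adj e (x.1 0)
  · rw [shift_cons h, mul_assoc]
  · simp [P.backward_of_not_adj h]

variable {m : Measure G.Path}

theorem Perron.IsInvariant.integral_comp_shift (hm : P.IsInvariant m) {w : G.Path → ℝ}
    (hw : Continuous w) : ∫ x, w (shift x) ∂m = ∫ x, w x ∂m := by
  refine (hm.integral_average (fun x => w (shift x)) (hw.comp continuous_shift)).symm.trans ?_
  refine integral_congr_ae (Eventually.of_forall fun x => ?_)
  have := P.average_mul_comp_shift (fun _ => 1) w x
  simpa [Perron.average, P.sum_backward] using this

theorem continuous_birkhoffSum {ψ : G.Path → ℝ} (hψ : Continuous ψ) (n : ℕ) :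
    Continuous (birkhoffSum shift ψ n) :=
  continuous_finsetSum _ fun i _ => hψ.comp (continuous_shift.iterate i)

/-- A function of zero average is orthogonal to every continuous function of the shifted path.
Splitting off the first term of the Birkhoff sum therefore leaves no cross term. -/
theorem Perron.IsInvariant.integral_birkhoffSum_sq (hm : P.IsInvariant m) {ψ : G.Path → ℝ}
    (hψ : Continuous ψ) (h0 : ∀ x, P.average ψ x = 0) (n : ℕ) :
    ∫ x, birkhoffSum shift ψ n x ^ 2 ∂m = n * ∫ x, ψ x ^ 2 ∂m := by
  have := hm.prob
  induction n with
  | zero => simp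
  | succ n ih =>
    have hc := continuous_birkhoffSum hψ n
    have h1 : ∀ x, birkhoffSum shift ψ (n + 1) x ^ 2 = ψ x ^ 2 +
        (2 * (ψ x * birkhoffSum shift ψ n (shift x)) + birkhoffSum shift ψ n (shift x) ^ 2) := by
      intro x; rw [birkhoffSum_succ']; ring
    have h2 : ∫ x, ψ x * birkhoffSum shift ψ n (shift x) ∂m = 0 := by
      refine (hm.integral_average (fun x => ψ x * birkhoffSum shift ψ n (shift x))
        (hψ.mul (hc.comp continuous_shift))).symm.trans ?_
      simp [P.average_mul_comp_shift, h0]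
    simp only [h1]
    have hi1 : Integrable (fun x => ψ x ^ 2) m := integrable_of_continuous (hψ.pow 2) m
    have hi2 : Integrable (fun x => 2 * (ψ x * birkhoffSum shift ψ n (shift x))) m :=
      integrable_of_continuous (continuous_const.mul (hψ.mul (hc.comp continuous_shift))) m
    have hi3 : Integrable (fun x => birkhoffSum shift ψ n (shift x) ^ 2) m :=
      integrable_of_continuous ((hc.comp continuous_shift).pow 2) m
    have hi4 : Integrable (fun x => 2 * (ψ x * birkhoffSum shift ψ n (shift x)) +
        birkhoffSum shift ψ n (shift x) ^ 2) m := hi2.add hi3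
    rw [integral_add hi1 hi4, integral_add hi2 hi3, integral_const_mul, h2,
      hm.integral_comp_shift (w := fun x => birkhoffSum shift ψ n x ^ 2) (hc.pow 2), ih]
    push_cast
    ring

/-- The variance of an edge function in terms of a solution `H` of Poisson's equation for the
reversed Markov chain. -/
theorem Perron.IsInvariant.tendsto_varianceSeq (hm : P.IsInvariant m) {φ : G.EdgeFun}
    {H : G.DEdge → ℝ} {c : ℝ}
    (hH : ∀ e', H e' = φ e'.1 - c + ∑ e, P.backward e' e * H e) :
    Tendsto (varianceSeq (onPath φ) m) atTop (𝓝 (∑ e', headProb m e' *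
      ∑ e, P.backward e' e * (H e - ∑ e, P.backward e' e * H e) ^ 2)) := by
  have := hm.prob
  set A : G.DEdge → ℝ := fun e' => ∑ e, P.backward e' e * H e with hA
  -- Here `ψ` is H minus its conditional expectation given the later edges. Poisson's equation then
  -- gives φ - c = ψ + (A ∘ shift - A), with a coboundary that telescopes to a bounded term.
  set ψ : G.Path → ℝ := fun x => H (x.1 0) - A (x.1 1) with hψ
  have hcA : Continuous fun x : G.Path => A (x.1 0) := continuous_comp_coord A 0
  have hcψ : Continuous ψ := (continuous_comp_coord H 0).sub (continuous_comp_coord A 1)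
  have hψcons : ∀ x e, G.Adj e (x.1 0) → ψ (cons e x) = H e - A (x.1 0) := by
    intro x e he
    simp only [hψ, cons_zero he, cons_succ he]
  have h0 : ∀ x, P.average ψ x = 0 := by
    intro x
    rw [P.average_eq (hψcons x)]
    simp only [mul_sub, Finset.sum_sub_distrib, ← Finset.sum_mul, P.sum_backward, one_mul]
    exact sub_self _
  have hψsq : ∫ x, ψ x ^ 2 ∂m = ∑ e', headProb m e' *
      ∑ e, P.backward e' e * (H e - ∑ e, P.backward e' e * H e) ^ 2 := by
    refine (hm.integral_average (fun x => ψ x ^ 2) (hcψ.pow 2)).symm.trans ?_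
    rw [← integral_comp_head]
    refine integral_congr_ae (Eventually.of_forall fun x => ?_)
    exact P.average_eq fun e he => by rw [hψcons x e he]
  have hφ : ∀ x, onPath φ x = c + ψ x + (A ((shift x).1 0) - A (x.1 0)) := by
    intro x
    have := hH (x.1 0)
    simp only [hψ, hA, onPath, shift] at this ⊢
    linarith
  have hmean : ∫ x, onPath φ x ∂m = c := by
    simp only [hφ]
    have hcs : Continuous fun x : G.Path => A ((shift x).1 0) := hcA.comp continuous_shift
    have hi1 : Integrable (fun x => c + ψ x) m :=
      integrable_of_continuous (continuous_const.add hcψ) m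
    have hi2 := integrable_of_continuous hcs m
    have hi3 := integrable_of_continuous hcA m
    have hi4 : Integrable (fun x : G.Path => A ((shift x).1 0) - A (x.1 0)) m := hi2.sub hi3
    rw [integral_add hi1 hi4,
      integral_add (integrable_const c) (integrable_of_continuous hcψ m), integral_sub hi2 hi3,
      hm.integral_comp_shift hcA, ← hm.integral_average _ hcψ]
    simp [h0]
  have hS : ∀ n x, birkhoffSum shift (onPath φ) n x - n * c =
      birkhoffSum shift ψ n x + (A ((shift^[n] x).1 0) - A (x.1 0)) := by
    intro n x
    induction n with
    | zero => simp
    | succ n ih =>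
      rw [birkhoffSum_succ, birkhoffSum_succ, hφ, Function.iterate_succ_apply']
      push_cast
      linarith
  rw [← hψsq]
  have hvar : varianceSeq (onPath φ) m = fun n : ℕ => 1 / (n : ℝ) * ∫ x, (birkhoffSum shift ψ n x +
      (A ((shift^[n] x).1 0) - A (x.1 0))) ^ 2 ∂m := by
    funext n
    simp only [varianceSeq, hmean, hS]
  rw [hvar]
  refine tendsto_second_moment_add_bounded (K := 2 * ∑ e, |A e|)
    (fun n => integrable_of_continuous ((continuous_birkhoffSum hcψ n).pow 2) m)
    (fun n => integrable_of_continuous (((continuous_birkhoffSum hcψ n).add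
      ((hcA.comp (continuous_shift.iterate n)).sub hcA)).pow 2) m)
    (hm.integral_birkhoffSum_sq hcψ h0) fun n x => ?_
  have hle : ∀ e, |A e| ≤ ∑ e, |A e| := fun e =>
    Finset.single_le_sum (f := fun e => |A e|) (fun _ _ => abs_nonneg _) (Finset.mem_univ e)
  refine (abs_sub _ _).trans ?_
  linarith [hle ((shift^[n] x).1 0), hle (x.1 0)]

end FinGraph

/-! ### Entropy by counting paths -/

/-- A function pinched between two multiples of `e^{hT}` has exponential growth rate `h`. -/
theorem tendsto_log_div_of_exp_bounds {N : ℝ → ℝ} {h c C : ℝ} (hh : 0 < h) (hc : 0 < c)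
    (hlow : ∀ᶠ T in atTop, c * Real.exp (h * T) - 1 ≤ N T)
    (hup : ∀ᶠ T in atTop, N T ≤ C * Real.exp (h * T)) :
    Tendsto (fun T : ℝ => 1 / T * Real.log (N T)) atTop (𝓝 h) := by
  have hexp : Tendsto (fun T : ℝ => c / 2 * Real.exp (h * T)) atTop atTop :=
    (Real.tendsto_exp_atTop.comp (tendsto_id.const_mul_atTop hh)).const_mul_atTop (by positivity)
  have hlim : ∀ k : ℝ, Tendsto (fun T : ℝ => k * (1 / T) + h) atTop (𝓝 h) := by
    intro k
    have : Tendsto (fun T : ℝ => k * (1 / T) + h) atTop (𝓝 (k * 0 + h)) := by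
      simp only [one_div]
      exact (tendsto_inv_atTop_zero.const_mul k).add_const h
    simpa using this
  refine tendsto_of_tendsto_of_tendsto_of_le_of_le' (hlim (Real.log (c / 2))) (hlim (Real.log C))
    ?_ ?_
  · filter_upwards [hlow, hexp.eventually_ge_atTop 1, eventually_gt_atTop 0] with T h1 h2 hT
    have h3 : c / 2 * Real.exp (h * T) ≤ N T := by linarith
    have h4 := Real.log_le_log (by positivity) h3
    rw [Real.log_mul (by positivity) (Real.exp_pos _).ne', Real.log_exp] at h4
    have h5 : Real.log (c / 2) * (1 / T) + h = 1 / T * (Real.log (c / 2) + h * T) := by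
      field_simp
    rw [h5]
    exact mul_le_mul_of_nonneg_left h4 (by positivity)
  · filter_upwards [hlow, hup, hexp.eventually_ge_atTop 1, eventually_gt_atTop 0] with T h1 h1' h2 hT
    have h3 : 0 < N T := by linarith
    have hC : 0 < C := pos_of_mul_pos_left (h3.trans_le h1') (Real.exp_pos _).le
    have h4 := Real.log_le_log h3 h1'
    rw [Real.log_mul hC.ne' (Real.exp_pos _).ne', Real.log_exp] at h4
    have h5 : Real.log C * (1 / T) + h = 1 / T * (Real.log C + h * T) := by
      field_simp
    rw [h5]
    exact mul_le_mul_of_nonneg_left h4 (by positivity)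

namespace FinGraph

variable {G : FinGraph} {l : G.EdgeFun}

/-- Finite non-backtracking paths from `e` to `a` of length less than `T` (the last edge `a` is not
counted in the length). -/
def pathsTo (l : G.EdgeFun) (a e : G.DEdge) (T : ℝ) : Set (Σ n : ℕ, Fin (n + 1) → G.DEdge) :=
  {γ | (∀ i : Fin γ.1, G.Adj (γ.2 i.castSucc) (γ.2 i.succ)) ∧ γ.2 0 = e ∧
    γ.2 (Fin.last γ.1) = a ∧ ∑ i : Fin γ.1, l (γ.2 i.castSucc).1 < T}

theorem exists_pos_le (hl : ∀ e, 0 < l e) : ∃ δ > 0, ∀ e, δ ≤ l e := by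
  rcases isEmpty_or_nonempty (Fin G.numEdges) with hE | hE
  · exact ⟨1, one_pos, fun e => (hE.false e).elim⟩
  · obtain ⟨e₀, h⟩ := Finite.exists_min l
    exact ⟨l e₀, hl e₀, h⟩

theorem finite_pathsTo (hl : ∀ e, 0 < l e) (a e : G.DEdge) (T : ℝ) : (pathsTo l a e T).Finite := by
  obtain ⟨δ, hδ, hle⟩ := exists_pos_le hl
  obtain ⟨N, hN⟩ := exists_nat_gt (T / δ)
  have hfin : (⋃ n ∈ Set.Iio N, Set.range fun γ : Fin (n + 1) → G.DEdge =>
      (⟨n, γ⟩ : Σ n : ℕ, Fin (n + 1) → G.DEdge)).Finite :=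
    Set.Finite.biUnion (Set.finite_Iio N) fun n _ => Set.finite_range _
  refine hfin.subset ?_
  rintro ⟨n, γ⟩ ⟨-, -, -, hT⟩
  simp only [Set.mem_iUnion, Set.mem_Iio, Set.mem_range]
  refine ⟨n, ?_, γ, rfl⟩
  have h1 : (n : ℝ) * δ ≤ ∑ i : Fin n, l (γ i.castSucc).1 := by
    have := Finset.card_nsmul_le_sum Finset.univ (fun i : Fin n => l (γ i.castSucc).1) δ
      fun i _ => hle _
    simpa using this
  have h2 : (n : ℝ) < T / δ := by rw [lt_div_iff₀ hδ]; exact h1.trans_lt hT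
  exact_mod_cast h2.trans hN

/-- Prepend a directed edge to a finite sequence. -/
def finCons (e : G.DEdge) (γ : Σ n : ℕ, Fin (n + 1) → G.DEdge) : Σ n : ℕ, Fin (n + 1) → G.DEdge :=
  ⟨γ.1 + 1, Fin.cons e γ.2⟩

theorem finCons_injective (e : G.DEdge) : Function.Injective (finCons e) := by
  rintro ⟨n, γ⟩ ⟨n', γ'⟩ h
  simp only [finCons, Sigma.mk.injEq, Nat.add_right_cancel_iff] at h
  obtain ⟨rfl, h⟩ := h
  have := Fin.cons_injective2.eq_iff.1 (eq_of_heq h)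
  simp [this.2]

theorem finCons_mem_pathsTo {a e e' : G.DEdge} (he : G.Adj e e') {T : ℝ}
    {γ : Σ n : ℕ, Fin (n + 1) → G.DEdge} (hγ : γ ∈ pathsTo l a e' (T - l e.1)) :
    finCons e γ ∈ pathsTo l a e T := by
  obtain ⟨n, γ⟩ := γ
  obtain ⟨h1, h2, h3, h4⟩ := hγ
  simp only at h1 h2 h3 h4
  refine ⟨?_, rfl, ?_, ?_⟩
  · intro i
    refine Fin.cases ?_ (fun j => ?_) i
    · change G.Adj e (γ 0)
      rw [h2]; exact he
    · exact h1 j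
  · change (Fin.cons e γ : Fin (n + 2) → G.DEdge) (Fin.last (n + 1)) = a
    rw [← Fin.succ_last, Fin.cons_succ, h3]
  · change ∑ i : Fin (n + 1), l ((Fin.cons e γ : Fin (n + 2) → G.DEdge) i.castSucc).1 < T
    rw [Fin.sum_univ_succ]
    have : ∑ i : Fin n, l ((Fin.cons e γ : Fin (n + 2) → G.DEdge) i.succ.castSucc).1 =
      ∑ i : Fin n, l (γ i.castSucc).1 := rfl
    rw [this, Fin.castSucc_zero, Fin.cons_zero]
    linarith

theorem pathsTo_subset (l : G.EdgeFun) (a e : G.DEdge) (T : ℝ) : pathsTo l a e T ⊆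
    {⟨0, fun _ => e⟩} ∪ ⋃ e' ∈ Finset.univ.filter (G.Adj e),
      finCons e '' pathsTo l a e' (T - l e.1) := by
  rintro ⟨n, γ⟩ ⟨h1, h2, h3, h4⟩
  cases n with
  | zero =>
    left
    have : γ = fun _ => e := by
      funext i
      rw [show i = (0 : Fin (0 + 1)) by omega]
      exact h2
    rw [this]; rfl
  | succ n =>
    right
    simp only at h1 h2 h3 h4
    have hcons : γ = Fin.cons e (fun i => γ i.succ) := by
      rw [← h2]; exact (Fin.cons_self_tail γ).symm
    simp only [Set.mem_iUnion, Finset.mem_filter, Finset.mem_univ, true_and]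
    refine ⟨γ 1, ?_, ⟨n, fun i => γ i.succ⟩, ⟨?_, rfl, ?_, ?_⟩, ?_⟩
    · rw [← h2]; exact h1 0
    · intro i; exact h1 i.succ
    · rw [← h3]; rfl
    · rw [Fin.sum_univ_succ, Fin.castSucc_zero, h2] at h4
      change ∑ i : Fin n, l (γ i.castSucc.succ).1 < T - l e.1
      have : ∀ i : Fin n, i.succ.castSucc = i.castSucc.succ := fun i => rfl
      simp only [this] at h4
      linarith
    · rw [finCons]; exact congrArg (Sigma.mk (n + 1)) hcons.symm

/-- Removing the first edge gives a recursion in the length. The extra 1 counts the path without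
steps; `sum_ncard_pathsTo_le` is the reverse inequality without it. -/
theorem ncard_pathsTo_le (hl : ∀ e, 0 < l e) (a e : G.DEdge) (T : ℝ) :
    (pathsTo l a e T).ncard ≤
      1 + ∑ e' ∈ Finset.univ.filter (G.Adj e), (pathsTo l a e' (T - l e.1)).ncard := by
  have hfin : (⋃ e' ∈ Finset.univ.filter (G.Adj e),
      finCons e '' pathsTo l a e' (T - l e.1)).Finite :=
    Set.Finite.biUnion (Finset.finite_toSet _) fun e' _ => (finite_pathsTo hl _ _ _).image _
  refine (Set.ncard_le_ncard (pathsTo_subset l a e T) ((Set.finite_singleton _).union hfin)).trans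
    ((Set.ncard_union_le _ _).trans ?_)
  rw [Set.ncard_singleton]
  refine Nat.add_le_add_left ((Finset.set_ncard_biUnion_le _ _).trans ?_) 1
  exact Finset.sum_le_sum fun e' _ => Set.ncard_image_le (finite_pathsTo hl _ _ _)

theorem sum_ncard_pathsTo_le (hl : ∀ e, 0 < l e) (a e : G.DEdge) (T : ℝ) :
    ∑ e' ∈ Finset.univ.filter (G.Adj e), (pathsTo l a e' (T - l e.1)).ncard ≤
      (pathsTo l a e T).ncard := by
  have hfin := fun e' => finite_pathsTo hl a e' (T - l e.1)
  have : Finite (pathsTo l a e T) := finite_pathsTo hl a e T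
  have : ∀ e', Finite (pathsTo l a e' (T - l e.1)) := hfin
  have h1 : ∑ e' ∈ Finset.univ.filter (G.Adj e), (pathsTo l a e' (T - l e.1)).ncard =
      Nat.card (Σ e' : {e' // G.Adj e e'}, pathsTo l a e'.1 (T - l e.1)) := by
    rw [Nat.card_sigma, Finset.sum_subtype (p := G.Adj e) _ (by simp)]
    rfl
  rw [h1, ← Nat.card_coe_set_eq]
  refine Nat.card_le_card_of_injective
    (fun p => ⟨finCons e p.2.1, finCons_mem_pathsTo p.1.2 p.2.2⟩) ?_
  rintro ⟨⟨e₁, he₁⟩, γ₁, hγ₁⟩ ⟨⟨e₂, he₂⟩, γ₂, hγ₂⟩ h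
  obtain rfl : γ₁ = γ₂ := finCons_injective e (congrArg Subtype.val h)
  obtain rfl : e₁ = e₂ := hγ₁.2.1.symm.trans hγ₂.2.1
  rfl

theorem pathsTo_eq_empty (hl : ∀ e, 0 < l e) (a e : G.DEdge) {T : ℝ} (hT : T ≤ 0) :
    pathsTo l a e T = ∅ := by
  ext γ
  simp only [Set.mem_empty_iff_false, iff_false]
  rintro ⟨-, -, -, h⟩
  exact absurd (Finset.sum_nonneg fun i _ => (hl (γ.2 i.castSucc).1).le) (not_le.2 (h.trans_le hT))

theorem exists_le (l : G.EdgeFun) : ∃ L, ∀ e, l e ≤ L :=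
  ⟨∑ e, |l e|, fun e => (le_abs_self _).trans
    (Finset.single_le_sum (f := fun e => |l e|) (fun _ _ => abs_nonneg _) (Finset.mem_univ e))⟩

variable {h : ℝ} {u : G.DEdge → ℝ}

/-- The eigenvector equation says that u(e) exp(hT) solves the counting recursion without its
constant term. It is the comparison function for both bounds. -/
theorem sum_adj_exp_mul (hu : ∀ e, ∑ e', weight (h • l) e e' * u e' = u e) (e : G.DEdge) (T : ℝ) :
    ∑ e' ∈ Finset.univ.filter (G.Adj e), u e' * Real.exp (h * (T - l e.1)) =
      u e * Real.exp (h * T) := by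
  rw [← hu e, Finset.sum_filter, Finset.sum_mul]
  refine Finset.sum_congr rfl fun e' _ => ?_
  by_cases he : G.Adj e e'
  · rw [if_pos he, weight_of_adj he, mul_right_comm, ← Real.exp_add, mul_comm]
    congr 2
    simp; ring
  · rw [if_neg he, weight_of_not_adj he]; ring

theorem exists_ncard_pathsTo_le (hl : ∀ e, 0 < l e) (hh : 0 < h) (hupos : ∀ e, 0 < u e)
    (hu : ∀ e, ∑ e', weight (h • l) e e' * u e' = u e)
    (hdeg : ∀ e, 2 ≤ (Finset.univ.filter (G.Adj e)).card) (a : G.DEdge) :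
    ∃ C, ∀ e T, 0 ≤ T → ((pathsTo l a e T).ncard : ℝ) ≤ C * u e * Real.exp (h * T) := by
  obtain ⟨δ, hδ, hle⟩ := exists_pos_le hl
  obtain ⟨L, hL⟩ := exists_le l
  obtain ⟨C, hC⟩ : ∃ C, ∀ e, 1 ≤ C * u e * Real.exp (h * -L) := by
    refine ⟨∑ e, (u e * Real.exp (h * -L))⁻¹, fun e => ?_⟩
    have hp : ∀ e, 0 < u e * Real.exp (h * -L) := fun e => mul_pos (hupos e) (Real.exp_pos _)
    rw [mul_assoc, ← inv_mul_cancel₀ (hp e).ne']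
    exact mul_le_mul_of_nonneg_right (Finset.single_le_sum
      (f := fun e => (u e * Real.exp (h * -L))⁻¹) (fun e _ => (inv_pos.2 (hp e)).le)
      (Finset.mem_univ e)) (hp e).le
  -- Removing an edge lowers `T` by at least `δ`, which gives an induction, and by at most `L`,
  -- which is why the range starts at `-L`. The bound carries a `-1` to absorb the 1 of the
  -- recursion: with out-degree d ≥ 2 one has 1 - d ≤ -1.
  have key : ∀ (N : ℕ) (e : G.DEdge) (T : ℝ), -L ≤ T → T ≤ N * δ →
      ((pathsTo l a e T).ncard : ℝ) ≤ C * u e * Real.exp (h * T) - 1 := by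
    have hneg : ∀ (e : G.DEdge) (T : ℝ), -L ≤ T → T ≤ 0 →
        ((pathsTo l a e T).ncard : ℝ) ≤ C * u e * Real.exp (h * T) - 1 := by
      intro e T hT hT0
      rw [pathsTo_eq_empty hl a e hT0]
      have hCpos : 0 < C * u e := by
        by_contra hn
        have := mul_nonpos_of_nonpos_of_nonneg (not_lt.1 hn) (Real.exp_pos (h * -L)).le
        linarith [hC e]
      have := mul_le_mul_of_nonneg_left
        (Real.exp_le_exp.2 (mul_le_mul_of_nonneg_left hT hh.le)) hCpos.le
      simp only [Set.ncard_empty, Nat.cast_zero]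
      linarith [hC e]
    intro N
    induction N with
    | zero => intro e T hT hT0; exact hneg e T hT (by simpa using hT0)
    | succ N ih =>
      intro e T hT hTN
      rcases le_or_gt T 0 with hT0 | hT0
      · exact hneg e T hT hT0
      have h1 : ((pathsTo l a e T).ncard : ℝ) ≤ 1 + ∑ e' ∈ Finset.univ.filter (G.Adj e),
          ((pathsTo l a e' (T - l e.1)).ncard : ℝ) := by
        exact_mod_cast ncard_pathsTo_le hl a e T
      have h2 : ∑ e' ∈ Finset.univ.filter (G.Adj e), ((pathsTo l a e' (T - l e.1)).ncard : ℝ) ≤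
          ∑ e' ∈ Finset.univ.filter (G.Adj e),
            (C * (u e' * Real.exp (h * (T - l e.1))) - 1) := by
        refine Finset.sum_le_sum fun e' _ => ?_
        rw [← mul_assoc]
        refine ih e' _ (by linarith [hL e.1]) ?_
        push_cast at hTN
        linarith [hle e.1]
      rw [Finset.sum_sub_distrib, ← Finset.mul_sum, sum_adj_exp_mul hu, Finset.sum_const,
        nsmul_eq_mul, mul_one] at h2
      have h3 : (2 : ℝ) ≤ (Finset.univ.filter (G.Adj e)).card := by exact_mod_cast hdeg e
      linarith
  refine ⟨C, fun e T hT => ?_⟩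
  obtain ⟨N, hN⟩ := exists_nat_ge (T / δ)
  have := key N e T (by linarith [hl e.1, hL e.1]) ((div_le_iff₀ hδ).1 hN)
  linarith

theorem exists_one_le_ncard_pathsTo (hl : ∀ e, 0 < l e) (hG : G.Irreducible) (a : G.DEdge) :
    ∃ M, ∀ e T, M < T → 1 ≤ (pathsTo l a e T).ncard := by
  have h1 : ∀ e, ∃ M, ∀ T, M < T → 1 ≤ (pathsTo l a e T).ncard := by
    intro e
    induction hG e a using Relation.ReflTransGen.head_induction_on with
    | refl =>
      refine ⟨0, fun T hT => ?_⟩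
      rw [Nat.one_le_iff_ne_zero, ← Nat.pos_iff_ne_zero, Set.ncard_pos (finite_pathsTo hl _ _ _)]
      exact ⟨⟨0, fun _ => a⟩, fun i => i.elim0, rfl, rfl, by simpa using hT⟩
    | @head b c hbc _ ih =>
      obtain ⟨M, hM⟩ := ih
      refine ⟨M + l b.1, fun T hT => (hM (T - l b.1) (by linarith)).trans
        (le_trans ?_ (sum_ncard_pathsTo_le hl a b T))⟩
      exact Finset.single_le_sum (f := fun e' => (pathsTo l a e' (T - l b.1)).ncard)
        (fun _ _ => Nat.zero_le _) (by simpa using hbc)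
  choose M hM using h1
  refine ⟨∑ e, |M e|, fun e T hT => hM e T (lt_of_le_of_lt ?_ hT)⟩
  exact (le_abs_self _).trans (Finset.single_le_sum (f := fun e => |M e|)
    (fun _ _ => abs_nonneg _) (Finset.mem_univ e))

/-- On the window (M, M + L] there is at least one path, and `c` is chosen to make the lower bound
at most 1 there. Beyond the window, removing one edge keeps the length above `M`, so the recursion
propagates the bound. -/
theorem exists_le_ncard_pathsTo (hl : ∀ e, 0 < l e) (hh : 0 < h) (hupos : ∀ e, 0 < u e)
    (hu : ∀ e, ∑ e', weight (h • l) e e' * u e' = u e) (hG : G.Irreducible) (a : G.DEdge) :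
    ∃ c > 0, ∃ M, ∀ e T, M < T → c * u e * Real.exp (h * T) ≤ ((pathsTo l a e T).ncard : ℝ) := by
  obtain ⟨δ, hδ, hle⟩ := exists_pos_le hl
  obtain ⟨L, hL⟩ := exists_le l
  obtain ⟨M, hM⟩ := exists_one_le_ncard_pathsTo hl hG a
  have hsum : 0 < ∑ e, u e := (hupos a).trans_le
    (Finset.single_le_sum (fun e _ => (hupos e).le) (Finset.mem_univ a))
  refine ⟨(Real.exp (h * (M + L)) * ∑ e, u e)⁻¹, by positivity, M, ?_⟩
  set c := (Real.exp (h * (M + L)) * ∑ e, u e)⁻¹ with hc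
  have hcpos : 0 < c := by positivity
  have hbase : ∀ (e : G.DEdge) (T : ℝ), M < T → T ≤ M + L →
      c * u e * Real.exp (h * T) ≤ ((pathsTo l a e T).ncard : ℝ) := by
    intro e T hMT hT
    have h1 : (1 : ℝ) ≤ ((pathsTo l a e T).ncard : ℝ) := by exact_mod_cast hM e T hMT
    refine le_trans ?_ h1
    rw [mul_assoc, hc, inv_mul_le_iff₀ (by positivity), mul_one, mul_comm]
    exact mul_le_mul (Real.exp_le_exp.2 (mul_le_mul_of_nonneg_left hT hh.le))
      (Finset.single_le_sum (fun e _ => (hupos e).le) (Finset.mem_univ e)) (hupos e).le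
      (Real.exp_pos _).le
  have key : ∀ (N : ℕ) (e : G.DEdge) (T : ℝ), M < T → T ≤ M + L + N * δ →
      c * u e * Real.exp (h * T) ≤ ((pathsTo l a e T).ncard : ℝ) := by
    intro N
    induction N with
    | zero => intro e T hMT hT; exact hbase e T hMT (by simpa using hT)
    | succ N ih =>
      intro e T hMT hT
      rcases le_or_gt T (M + L) with hT0 | hT0
      · exact hbase e T hMT hT0
      have h1 : ∑ e' ∈ Finset.univ.filter (G.Adj e), ((pathsTo l a e' (T - l e.1)).ncard : ℝ) ≤
          ((pathsTo l a e T).ncard : ℝ) := by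
        exact_mod_cast sum_ncard_pathsTo_le hl a e T
      refine le_trans ?_ h1
      rw [mul_assoc, ← sum_adj_exp_mul hu, Finset.mul_sum]
      refine Finset.sum_le_sum fun e' _ => ?_
      rw [← mul_assoc]
      push_cast at hT
      exact ih e' _ (by linarith [hL e.1]) (by linarith [hle e.1])
  intro e T hT
  obtain ⟨N, hN⟩ := exists_nat_ge ((T - (M + L)) / δ)
  exact key N e T hT (by linarith [(div_le_iff₀ hδ).1 hN])

/-- The entropy is the number `h` for which the weighted adjacency matrix of `h l` has a positive
eigenvector for the eigenvalue one. -/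
theorem hasEntropy_of_eigenvector [Nonempty G.DEdge] (hl : ∀ e, 0 < l e) (hh : 0 < h)
    (hupos : ∀ e, 0 < u e) (hu : ∀ e, ∑ e', weight (h • l) e e' * u e' = u e)
    (hdeg : ∀ e, 2 ≤ (Finset.univ.filter (G.Adj e)).card) (hG : G.Irreducible) :
    G.HasEntropy l h := by
  obtain ⟨a⟩ := ‹Nonempty G.DEdge›
  obtain ⟨c, hc, M, hlow⟩ := exists_le_ncard_pathsTo hl hh hupos hu hG a
  choose C hC using exists_ncard_pathsTo_le hl hh hupos hu hdeg
  have hsub : ∀ T, G.cyclesBelow l T ⊆ ⋃ b ∈ (Finset.univ : Finset G.DEdge), pathsTo l b b T := by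
    rintro T γ ⟨-, h1, h2, h3⟩
    simp only [Set.mem_iUnion, Finset.mem_univ, exists_const]
    exact ⟨γ.2 0, h1, rfl, h2, h3⟩
  have hfin : ∀ T, (⋃ b ∈ (Finset.univ : Finset G.DEdge), pathsTo l b b T).Finite := fun T =>
    Set.Finite.biUnion (Finset.finite_toSet _) fun b _ => finite_pathsTo hl _ _ _
  refine tendsto_log_div_of_exp_bounds (c := c * u a) (C := ∑ b, C b * u b) hh
    (mul_pos hc (hupos a)) ?_ ?_
  · filter_upwards [eventually_gt_atTop M] with T hT
    -- The stepless path is not a cycle, whence the `-1` in the lower bound.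
    have h1 : pathsTo l a a T ⊆ G.cyclesBelow l T ∪ {⟨0, fun _ => a⟩} := by
      rintro ⟨n, γ⟩ ⟨h1, h2, h3, h4⟩
      cases n with
      | zero =>
        right
        have : γ = fun _ => a := by
          funext i
          rw [show i = (0 : Fin (0 + 1)) by omega]
          exact h2
        rw [this]; rfl
      | succ n => exact Or.inl ⟨by simp, h1, h3.trans h2.symm, h4⟩
    have h2 := (Set.ncard_le_ncard h1 (((hfin T).subset (hsub T)).union
      (Set.finite_singleton _))).trans (Set.ncard_union_le _ _)
    rw [Set.ncard_singleton] at h2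
    have h3 : ((pathsTo l a a T).ncard : ℝ) ≤ (G.cyclesBelow l T).ncard + 1 := by exact_mod_cast h2
    linarith [hlow a T hT]
  · filter_upwards [eventually_ge_atTop 0] with T hT
    have h1 := (Set.ncard_le_ncard (hsub T) (hfin T)).trans (Finset.set_ncard_biUnion_le _ _)
    have h2 : ((G.cyclesBelow l T).ncard : ℝ) ≤ ∑ b, ((pathsTo l b b T).ncard : ℝ) := by
      exact_mod_cast h1
    rw [Finset.sum_mul]
    exact h2.trans (Finset.sum_le_sum fun b _ => hC b b T hT)

end FinGraph

/-! ### The dumbbell: eigenvectors and the equation of the surface -/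

namespace Dumbbell

open FinGraph

theorem forall_dedge {p : dumbbell.DEdge → Prop} (h₁ : p ((0 : Fin 3), true))
    (h₂ : p ((0 : Fin 3), false)) (h₃ : p ((1 : Fin 3), true)) (h₄ : p ((1 : Fin 3), false))
    (h₅ : p ((2 : Fin 3), true)) (h₆ : p ((2 : Fin 3), false)) : ∀ e, p e := by
  have : ∀ (i : Fin 3) (b : Bool), p (i, b) := by
    intro i b
    fin_cases i <;> cases b <;> assumption
  exact fun e => this e.1 e.2

theorem sum_dedge (f : dumbbell.DEdge → ℝ) : ∑ e, f e =
    f ((0 : Fin 3), true) + f ((0 : Fin 3), false) + f ((1 : Fin 3), true) +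
      f ((1 : Fin 3), false) + f ((2 : Fin 3), true) + f ((2 : Fin 3), false) := by
  have : ∑ e, f e = ∑ i : Fin 3, ∑ b : Bool, f (i, b) := Fintype.sum_prod_type f
  rw [this]
  simp only [Fin.sum_univ_three, Fintype.sum_bool]
  ring

instance : Nonempty dumbbell.DEdge := ⟨((0 : Fin 3), true)⟩

theorem irreducible : dumbbell.Irreducible := by
  have h : ∀ {e e'}, dumbbell.Adj e e' → Relation.ReflTransGen dumbbell.Adj e e' :=
    Relation.ReflTransGen.single
  have h1 : Relation.ReflTransGen dumbbell.Adj ((0 : Fin 3), true) ((2 : Fin 3), true) :=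
    h (by decide)
  have h2 := h1.trans (h (e' := ((1 : Fin 3), true)) (by decide))
  have h3 := h1.trans (h (e' := ((1 : Fin 3), false)) (by decide))
  have h4 := h2.trans (h (e' := ((2 : Fin 3), false)) (by decide))
  have h5 := h4.trans (h (e' := ((0 : Fin 3), false)) (by decide))
  have k1 : Relation.ReflTransGen dumbbell.Adj ((2 : Fin 3), false) ((0 : Fin 3), true) :=
    h (by decide)
  have k2 := (h (e := ((1 : Fin 3), true)) (by decide)).trans k1
  have k3 := (h (e := ((1 : Fin 3), false)) (by decide)).trans k1
  have k4 := (h (e := ((2 : Fin 3), true)) (by decide)).trans k2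
  have k5 := (h (e := ((0 : Fin 3), false)) (by decide)).trans k4
  have hto : ∀ e, Relation.ReflTransGen dumbbell.Adj e ((0 : Fin 3), true) :=
    forall_dedge .refl k5 k2 k3 k4 k1
  have hfrom : ∀ e, Relation.ReflTransGen dumbbell.Adj ((0 : Fin 3), true) e :=
    forall_dedge .refl h5 h2 h3 h1 h4
  exact fun e e' => (hto e).trans (hfrom e')

theorem two_le_degree : ∀ e, 2 ≤ (Finset.univ.filter (dumbbell.Adj e)).card := by
  refine forall_dedge ?_ ?_ ?_ ?_ ?_ ?_ <;> decide

/-- The function of directed edges that takes the values `a`, `b` on the loops and `c`, `c'` on the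
two directions of the bridge. -/
def edgeFn (a b c c' : ℝ) (e : dumbbell.DEdge) : ℝ :=
  (![fun _ => a, fun _ => b, fun t => if t then c else c'] : Fin 3 → Bool → ℝ) e.1 e.2

variable {a b c c' : ℝ}

theorem edgeFn_loop_left (t : Bool) : edgeFn a b c c' ((0 : Fin 3), t) = a := rfl

theorem edgeFn_loop_right (t : Bool) : edgeFn a b c c' ((1 : Fin 3), t) = b := rfl

theorem edgeFn_bridge : edgeFn a b c c' ((2 : Fin 3), true) = c := rfl

theorem edgeFn_bridge_rev : edgeFn a b c c' ((2 : Fin 3), false) = c' := rfl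

theorem edgeFn_pos (ha : 0 < a) (hb : 0 < b) (hc : 0 < c) (hc' : 0 < c') :
    ∀ e, 0 < edgeFn a b c c' e :=
  forall_dedge ha ha hb hb hc hc'

/-- Reversing a loop is a symmetry, so the functions `edgeFn` form a four-dimensional invariant
space in which the eigenvector can be sought. -/
theorem sum_weight_mul_edgeFn (l : dumbbell.EdgeFun) (e : dumbbell.DEdge) :
    ∑ e', weight l e e' * edgeFn a b c c' e' =
      edgeFn (Real.exp (-l (0 : Fin 3)) * (a + c)) (Real.exp (-l (1 : Fin 3)) * (b + c'))
        (Real.exp (-l (2 : Fin 3)) * (2 * b)) (Real.exp (-l (2 : Fin 3)) * (2 * a)) e := by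
  rw [sum_dedge]
  revert e
  refine forall_dedge ?_ ?_ ?_ ?_ ?_ ?_ <;>
    simp +decide only [weight, if_true, if_false, edgeFn_loop_left, edgeFn_loop_right,
      edgeFn_bridge, edgeFn_bridge_rev] <;> ring

theorem sum_weight_transpose_mul_edgeFn (l : dumbbell.EdgeFun) (e' : dumbbell.DEdge) :
    ∑ e, weight l e e' * edgeFn a b c c' e =
      edgeFn (Real.exp (-l (0 : Fin 3)) * a + Real.exp (-l (2 : Fin 3)) * c')
        (Real.exp (-l (1 : Fin 3)) * b + Real.exp (-l (2 : Fin 3)) * c)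
        (Real.exp (-l (0 : Fin 3)) * (2 * a)) (Real.exp (-l (1 : Fin 3)) * (2 * b)) e' := by
  rw [sum_dedge]
  revert e'
  refine forall_dedge ?_ ?_ ?_ ?_ ?_ ?_ <;>
    simp +decide only [weight, if_true, if_false, edgeFn_loop_left, edgeFn_loop_right,
      edgeFn_bridge, edgeFn_bridge_rev] <;> ring

/-- The equation of the entropy-one moduli space of the dumbbell. -/
structure OnSurface (l : dumbbell.EdgeFun) : Prop where
  pos_left : 0 < l (0 : Fin 3)
  pos_right : 0 < l (1 : Fin 3)
  eq : (Real.exp (l (0 : Fin 3)) - 1) * (Real.exp (l (1 : Fin 3)) - 1) *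
    Real.exp (l (2 : Fin 3)) ^ 2 = 4

/-- The eigenvectors of the weighted adjacency matrix of the dumbbell. -/
def perron {l : dumbbell.EdgeFun} (hl : OnSurface l) : Perron l where
  left := edgeFn (Real.exp (l (0 : Fin 3)) / 2)
    (Real.exp (l (1 : Fin 3)) * (Real.exp (l (0 : Fin 3)) - 1) * Real.exp (l (2 : Fin 3)) / 4) 1
    ((Real.exp (l (0 : Fin 3)) - 1) * Real.exp (l (2 : Fin 3)) / 2)
  right := edgeFn (1 / (Real.exp (l (0 : Fin 3)) - 1))
    (Real.exp (l (2 : Fin 3)) / 2) 1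
    (2 / (Real.exp (l (2 : Fin 3)) * (Real.exp (l (0 : Fin 3)) - 1)))
  left_pos := by
    have h1 := sub_pos.2 (Real.one_lt_exp_iff.2 hl.pos_left)
    apply edgeFn_pos <;> positivity
  right_pos := by
    have h1 := sub_pos.2 (Real.one_lt_exp_iff.2 hl.pos_left)
    apply edgeFn_pos <;> positivity
  left_eq := by
    intro e'
    have h1 := sub_pos.2 (Real.one_lt_exp_iff.2 hl.pos_left)
    have h := hl.eq
    rw [sum_weight_transpose_mul_edgeFn]
    simp only [Real.exp_neg]
    have hx := Real.exp_pos (l (0 : Fin 3))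
    have hy := Real.exp_pos (l (1 : Fin 3))
    have hz := Real.exp_pos (l (2 : Fin 3))
    generalize Real.exp (l (0 : Fin 3)) = x at *
    generalize Real.exp (l (1 : Fin 3)) = y at *
    generalize Real.exp (l (2 : Fin 3)) = z at *
    congr 1
    · field_simp; ring
    -- The other components hold identically; the one on the right loop is the equation of the
    -- surface.
    · field_simp; linear_combination -h
    · field_simp
    · field_simp; norm_num
  right_eq := by
    intro e
    have h1 := sub_pos.2 (Real.one_lt_exp_iff.2 hl.pos_left)
    have h := hl.eq
    rw [sum_weight_mul_edgeFn]
    simp only [Real.exp_neg]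
    have hx := Real.exp_pos (l (0 : Fin 3))
    have hy := Real.exp_pos (l (1 : Fin 3))
    have hz := Real.exp_pos (l (2 : Fin 3))
    generalize Real.exp (l (0 : Fin 3)) = x at *
    generalize Real.exp (l (1 : Fin 3)) = y at *
    generalize Real.exp (l (2 : Fin 3)) = z at *
    congr 1
    · field_simp; ring
    · field_simp; linear_combination -h
    · field_simp
    · field_simp

theorem hasEntropy {l : dumbbell.EdgeFun} (hl : ∀ e, 0 < l e) {h : ℝ} (hh : 0 < h)
    (hs : OnSurface (h • l)) : dumbbell.HasEntropy l h :=
  hasEntropy_of_eigenvector hl hh (perron hs).right_pos (perron hs).right_eq two_le_degree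
    irreducible

theorem exists_onSurface {l : dumbbell.EdgeFun} (hl : ∀ e, 0 < l e) :
    ∃ h : ℝ, 0 < h ∧ OnSurface (h • l) := by
  have hx := hl (0 : Fin 3)
  have hy := hl (1 : Fin 3)
  have hz := hl (2 : Fin 3)
  set f : ℝ → ℝ := fun h => (Real.exp (h * l (0 : Fin 3)) - 1) *
    (Real.exp (h * l (1 : Fin 3)) - 1) * Real.exp (h * l (2 : Fin 3)) ^ 2 with hf
  have hcont : Continuous f := by fun_prop
  -- With this `k` both loops have scaled length at least 2, so both factors e^{kl} - 1 are at least
  -- 2 and `f k` is at least 4, whereas `f 0 = 0`.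
  set k : ℝ := 2 / l (0 : Fin 3) + 2 / l (1 : Fin 3) with hk
  have hkpos : 0 < k := by positivity
  have hkx : 2 ≤ k * l (0 : Fin 3) := by
    have : k * l (0 : Fin 3) = 2 + 2 / l (1 : Fin 3) * l (0 : Fin 3) := by
      rw [hk]; field_simp
    rw [this]; have : 0 < 2 / l (1 : Fin 3) * l (0 : Fin 3) := by positivity
    linarith
  have hky : 2 ≤ k * l (1 : Fin 3) := by
    have : k * l (1 : Fin 3) = 2 + 2 / l (0 : Fin 3) * l (1 : Fin 3) := by
      rw [hk]; field_simp; ring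
    rw [this]; have : 0 < 2 / l (0 : Fin 3) * l (1 : Fin 3) := by positivity
    linarith
  have h0 : f 0 ≤ 4 := by simp [hf]
  have h1 : 4 ≤ f k := by
    have e1 : 2 ≤ Real.exp (k * l (0 : Fin 3)) - 1 := by
      linarith [Real.add_one_le_exp (k * l (0 : Fin 3))]
    have e2 : 2 ≤ Real.exp (k * l (1 : Fin 3)) - 1 := by
      linarith [Real.add_one_le_exp (k * l (1 : Fin 3))]
    have e3 : 1 ≤ Real.exp (k * l (2 : Fin 3)) ^ 2 :=
      one_le_pow₀ (Real.one_le_exp (by positivity))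
    calc (4 : ℝ) = 2 * 2 * 1 := by norm_num
      _ ≤ f k := by
        have := mul_le_mul e1 e2 zero_le_two (by linarith)
        exact mul_le_mul this e3 zero_le_one (by linarith)
  obtain ⟨h, ⟨hh0, -⟩, hh⟩ := intermediate_value_Icc hkpos.le hcont.continuousOn ⟨h0, h1⟩
  have hpos : 0 < h := by
    rcases hh0.eq_or_lt with rfl | hp
    · simp [hf] at hh
    · exact hp
  exact ⟨h, hpos, mul_pos hpos hx, mul_pos hpos hy, hh⟩

/-- Some multiple h l lies on the surface, and then h is the entropy. Uniqueness of limits forces h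
= 1, so no monotonicity in h is needed. -/
theorem mem_moduliOne_iff (l : dumbbell.EdgeFun) :
    l ∈ dumbbell.moduliOne ↔ OnSurface l ∧ 0 < l (2 : Fin 3) := by
  constructor
  · rintro ⟨hl, h1⟩
    obtain ⟨h, hpos, hs⟩ := exists_onSurface hl
    obtain rfl := tendsto_nhds_unique (hasEntropy hl hpos hs) h1
    rw [one_smul] at hs
    exact ⟨hs, hl (2 : Fin 3)⟩
  · rintro ⟨hs, hz⟩
    have hl : ∀ e, 0 < l e := by
      have : ∀ i : Fin 3, 0 < l i := Fin.forall_fin_succ.2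
        ⟨hs.pos_left, Fin.forall_fin_two.2 ⟨hs.pos_right, hz⟩⟩
      exact this
    exact ⟨hl, hasEntropy hl one_pos (by rwa [one_smul])⟩

theorem onSurface_chart {p : Fin 2 → ℝ} (hx : 0 < p 0) (hy : 0 < p 1) :
    OnSurface (dumbbellChart p) := by
  have h1 := sub_pos.2 (Real.one_lt_exp_iff.2 hx)
  have h2 := sub_pos.2 (Real.one_lt_exp_iff.2 hy)
  refine ⟨hx, hy, ?_⟩
  change (Real.exp (p 0) - 1) * (Real.exp (p 1) - 1) * Real.exp (Real.log 2 - 1 / 2 *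
    Real.log ((Real.exp (p 0) - 1) * (Real.exp (p 1) - 1))) ^ 2 = 4
  rw [← Real.exp_nat_mul]
  have : ((2 : ℕ) : ℝ) * (Real.log 2 - 1 / 2 *
      Real.log ((Real.exp (p 0) - 1) * (Real.exp (p 1) - 1))) = Real.log 2 + Real.log 2 -
      Real.log ((Real.exp (p 0) - 1) * (Real.exp (p 1) - 1)) := by push_cast; ring
  rw [this, Real.exp_sub, Real.exp_add, Real.exp_log two_pos, Real.exp_log (mul_pos h1 h2)]
  field_simp
  norm_num

theorem eq_chart {l : dumbbell.EdgeFun} (hl : OnSurface l) :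
    l = dumbbellChart ![l (0 : Fin 3), l (1 : Fin 3)] := by
  have h1 := sub_pos.2 (Real.one_lt_exp_iff.2 hl.pos_left)
  have h2 := sub_pos.2 (Real.one_lt_exp_iff.2 hl.pos_right)
  have h := congrArg Real.log hl.eq
  have h4 : Real.log 4 = 2 * Real.log 2 := by
    rw [show (4 : ℝ) = 2 ^ 2 by norm_num, Real.log_pow]; norm_num
  rw [Real.log_mul (mul_pos h1 h2).ne' (by positivity), Real.log_pow, Real.log_exp, h4] at h
  have key : ∀ i : Fin 3, l i = dumbbellChart ![l (0 : Fin 3), l (1 : Fin 3)] i := by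
    refine Fin.forall_fin_succ.2 ⟨rfl, Fin.forall_fin_two.2 ⟨rfl, ?_⟩⟩
    change l (2 : Fin 3) = Real.log 2 - 1 / 2 *
      Real.log ((Real.exp (l (0 : Fin 3)) - 1) * (Real.exp (l (1 : Fin 3)) - 1))
    push_cast at h
    linarith
  exact funext key

theorem chart_bridge_pos_iff {p : Fin 2 → ℝ} (hx : 0 < p 0) (hy : 0 < p 1) :
    0 < dumbbellChart p (2 : Fin 3) ↔ (Real.exp (p 0) - 1) * (Real.exp (p 1) - 1) < 4 := by
  have hs := (onSurface_chart hx hy).eq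
  have h1 := sub_pos.2 (Real.one_lt_exp_iff.2 hx)
  have h2 := sub_pos.2 (Real.one_lt_exp_iff.2 hy)
  change (Real.exp (p 0) - 1) * (Real.exp (p 1) - 1) * _ = 4 at hs
  rw [← Real.one_lt_exp_iff]
  have hz := Real.exp_pos (dumbbellChart p (2 : Fin 3))
  have hw := mul_pos h1 h2
  generalize Real.exp (dumbbellChart p (2 : Fin 3)) = z at *
  generalize (Real.exp (p 0) - 1) * (Real.exp (p 1) - 1) = w at *
  constructor
  · intro h; nlinarith [mul_pos hw (mul_pos (sub_pos.2 h) (by linarith : 0 < z + 1))]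
  · intro h
    by_contra hn
    have : z ^ 2 ≤ 1 := pow_le_one₀ hz.le (not_lt.1 hn)
    nlinarith

theorem moduliOne_eq : dumbbell.moduliOne = dumbbellChart '' dumbbellDomain := by
  ext l
  rw [mem_moduliOne_iff]
  constructor
  · rintro ⟨hs, hz⟩
    refine ⟨![l (0 : Fin 3), l (1 : Fin 3)], ⟨hs.pos_left, hs.pos_right, ?_⟩, (eq_chart hs).symm⟩
    refine (chart_bridge_pos_iff (p := ![l (0 : Fin 3), l (1 : Fin 3)])
      hs.pos_left hs.pos_right).1 ?_
    rwa [← eq_chart hs]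
  · rintro ⟨p, ⟨hx, hy, hp⟩, rfl⟩
    exact ⟨onSurface_chart hx hy, (chart_bridge_pos_iff hx hy).2 hp⟩

end Dumbbell

/-! ### The equilibrium state and the variance of the dumbbell -/

namespace Dumbbell

open FinGraph

/-- Half the mass of the bridge for the equilibrium state, in terms of `x = e^{l(e₁)}` and
`y = e^{l(e₂)}`. -/
def bridgeMass (x y : ℝ) : ℝ := (x - 1) * (y - 1) / (4 * x * y - 3 * x - 3 * y + 2)

theorem denom_pos {x y : ℝ} (hx : 1 < x) (hy : 1 < y) : 0 < 4 * x * y - 3 * x - 3 * y + 2 := by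
  nlinarith [mul_pos (sub_pos.2 hx) (sub_pos.2 hy)]

/-- The integral of an edge function for the equilibrium state. -/
def meanValue (l φ : dumbbell.EdgeFun) : ℝ :=
  bridgeMass (Real.exp (l (0 : Fin 3))) (Real.exp (l (1 : Fin 3))) *
    (Real.exp (l (0 : Fin 3)) / (Real.exp (l (0 : Fin 3)) - 1) * φ (0 : Fin 3) +
      Real.exp (l (1 : Fin 3)) / (Real.exp (l (1 : Fin 3)) - 1) * φ (1 : Fin 3) +
      2 * φ (2 : Fin 3))

/-- The variance of an edge function for the equilibrium state. -/
def variance (l φ : dumbbell.EdgeFun) : ℝ :=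
  bridgeMass (Real.exp (l (0 : Fin 3))) (Real.exp (l (1 : Fin 3))) *
    (Real.exp (l (0 : Fin 3)) / (Real.exp (l (0 : Fin 3)) - 1) ^ 2 *
        (φ (0 : Fin 3) - meanValue l φ) ^ 2 +
      Real.exp (l (1 : Fin 3)) / (Real.exp (l (1 : Fin 3)) - 1) ^ 2 *
        (φ (1 : Fin 3) - meanValue l φ) ^ 2)

variable {l : dumbbell.EdgeFun}

/-- The reversed chain stays on a loop with probability e^{-l} and otherwise moves to the bridge;
from the bridge it takes either direction of a loop with probability 1/2. -/
theorem sum_backward_mul (hl : OnSurface l) (F : dumbbell.DEdge → ℝ) (e' : dumbbell.DEdge) :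
    ∑ e, (perron hl).backward e' e * F e =
      (![fun t => 1 / Real.exp (l (0 : Fin 3)) * F ((0 : Fin 3), t) +
          (1 - 1 / Real.exp (l (0 : Fin 3))) * F ((2 : Fin 3), false),
        fun t => 1 / Real.exp (l (1 : Fin 3)) * F ((1 : Fin 3), t) +
          (1 - 1 / Real.exp (l (1 : Fin 3))) * F ((2 : Fin 3), true),
        fun t => if t then (F ((0 : Fin 3), true) + F ((0 : Fin 3), false)) / 2
          else (F ((1 : Fin 3), true) + F ((1 : Fin 3), false)) / 2] :
        Fin 3 → Bool → ℝ) e'.1 e'.2 := by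
  rw [sum_dedge]
  simp only [Perron.backward, perron]
  have h1 := sub_pos.2 (Real.one_lt_exp_iff.2 hl.pos_left)
  have h := hl.eq
  have hx := Real.exp_pos (l (0 : Fin 3))
  have hy := Real.exp_pos (l (1 : Fin 3))
  have hz := Real.exp_pos (l (2 : Fin 3))
  revert e'
  refine forall_dedge ?_ ?_ ?_ ?_ ?_ ?_ <;>
    simp +decide only [weight, if_true, if_false, edgeFn_loop_left, edgeFn_loop_right,
      edgeFn_bridge, edgeFn_bridge_rev, Real.exp_neg, Matrix.cons_val_zero, Matrix.cons_val_one,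
      Matrix.cons_val] <;>
    generalize Real.exp (l (0 : Fin 3)) = x at * <;>
    generalize Real.exp (l (1 : Fin 3)) = y at * <;>
    generalize Real.exp (l (2 : Fin 3)) = z at *
  iterate 2 (· field_simp; ring)
  iterate 2 (· field_simp; linear_combination (-2 * F ((2 : Fin 3), true)) * h)
  iterate 2 (· field_simp; ring)

/-- A solution of Poisson's equation for the reversed chain. -/
def poisson (l φ : dumbbell.EdgeFun) : dumbbell.DEdge → ℝ :=
  edgeFn (-(φ (2 : Fin 3) - meanValue l φ))
    (-2 * (φ (2 : Fin 3) - meanValue l φ) - (φ (0 : Fin 3) - meanValue l φ) *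
      (Real.exp (l (0 : Fin 3)) / (Real.exp (l (0 : Fin 3)) - 1))) 0
    (-(φ (2 : Fin 3) - meanValue l φ) - (φ (0 : Fin 3) - meanValue l φ) *
      (Real.exp (l (0 : Fin 3)) / (Real.exp (l (0 : Fin 3)) - 1)))

/-- This is the solvability condition of Poisson's equation: the centred function has mean zero for
the stationary law. -/
theorem sum_sub_meanValue (hl : OnSurface l) (φ : dumbbell.EdgeFun) :
    Real.exp (l (0 : Fin 3)) / (Real.exp (l (0 : Fin 3)) - 1) * (φ (0 : Fin 3) - meanValue l φ) +
      Real.exp (l (1 : Fin 3)) / (Real.exp (l (1 : Fin 3)) - 1) *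
        (φ (1 : Fin 3) - meanValue l φ) + 2 * (φ (2 : Fin 3) - meanValue l φ) = 0 := by
  have hx := Real.one_lt_exp_iff.2 hl.pos_left
  have hy := Real.one_lt_exp_iff.2 hl.pos_right
  simp only [meanValue, bridgeMass]
  generalize Real.exp (l (0 : Fin 3)) = x at *
  generalize Real.exp (l (1 : Fin 3)) = y at *
  have hx1 := (sub_pos.2 hx).ne'
  have hy1 := (sub_pos.2 hy).ne'
  have hD := (denom_pos hx hy).ne'
  obtain ⟨D, hDe⟩ : ∃ D, D = 4 * x * y - 3 * x - 3 * y + 2 := ⟨_, rfl⟩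
  rw [← hDe] at hD ⊢
  field_simp
  rw [hDe]
  ring

theorem poisson_eq (hl : OnSurface l) (φ : dumbbell.EdgeFun) (e' : dumbbell.DEdge) :
    poisson l φ e' = φ e'.1 - meanValue l φ +
      ∑ e, (perron hl).backward e' e * poisson l φ e := by
  have h := sum_sub_meanValue hl φ
  have hx := Real.one_lt_exp_iff.2 hl.pos_left
  have hy := Real.one_lt_exp_iff.2 hl.pos_right
  rw [sum_backward_mul]
  simp only [poisson]
  revert e'
  refine forall_dedge ?_ ?_ ?_ ?_ ?_ ?_ <;>
    simp only [if_true, if_false, Bool.false_eq_true, edgeFn_loop_left, edgeFn_loop_right,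
      edgeFn_bridge, edgeFn_bridge_rev, Matrix.cons_val_zero, Matrix.cons_val_one,
      Matrix.cons_val] <;>
    generalize meanValue l φ = c at * <;>
    generalize Real.exp (l (0 : Fin 3)) = x at * <;>
    generalize Real.exp (l (1 : Fin 3)) = y at *
  all_goals
    have hx1 := (sub_pos.2 hx).ne'
    have hy1 := (sub_pos.2 hy).ne'
    -- `poisson` is normalised to vanish on one direction of the bridge. The equation on the right
    -- loop is the one that needs the centring condition, used here to eliminate the bridge value.
    have h2 : φ (2 : Fin 3) - c = -(x / (x - 1) * (φ (0 : Fin 3) - c) +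
      y / (y - 1) * (φ (1 : Fin 3) - c)) / 2 := by linarith
    rw [h2]
    generalize φ (0 : Fin 3) - c = α at *
    generalize φ (1 : Fin 3) - c = β at *
    field_simp
    ring

theorem headProb_eqState (hl : OnSurface l) (e : dumbbell.DEdge) :
    headProb (eqState l) e =
      bridgeMass (Real.exp (l (0 : Fin 3))) (Real.exp (l (1 : Fin 3))) *
        edgeFn (Real.exp (l (0 : Fin 3)) / (2 * (Real.exp (l (0 : Fin 3)) - 1)))
          (Real.exp (l (1 : Fin 3)) / (2 * (Real.exp (l (1 : Fin 3)) - 1))) 1 1 e := by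
  have hx := Real.one_lt_exp_iff.2 hl.pos_left
  have hy := Real.one_lt_exp_iff.2 hl.pos_right
  have hz := Real.exp_pos (l (2 : Fin 3))
  have h := hl.eq
  have hprod : ∀ e, (perron hl).left e * (perron hl).right e =
      edgeFn (Real.exp (l (0 : Fin 3)) / (2 * (Real.exp (l (0 : Fin 3)) - 1)))
          (Real.exp (l (1 : Fin 3)) / (2 * (Real.exp (l (1 : Fin 3)) - 1))) 1 1 e := by
    refine forall_dedge ?_ ?_ ?_ ?_ ?_ ?_ <;>
    simp only [perron, edgeFn_loop_left, edgeFn_loop_right, edgeFn_bridge, edgeFn_bridge_rev] <;>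
    generalize Real.exp (l (0 : Fin 3)) = x at * <;>
    generalize Real.exp (l (1 : Fin 3)) = y at * <;>
    generalize Real.exp (l (2 : Fin 3)) = z at *
    all_goals
      have hx1 := (sub_pos.2 hx).ne'
      have hy1 := (sub_pos.2 hy).ne'
      have hz1 := hz.ne'
      have hz2 : z ^ 2 = 4 / ((x - 1) * (y - 1)) := by field_simp; linarith
    iterate 2 (· field_simp)
    iterate 2
      · rw [show y * (x - 1) * z / 4 * (z / 2) = y * (x - 1) / 8 * z ^ 2 by ring, hz2]
        field_simp
        norm_num
    iterate 2 (· field_simp)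
  rw [((perron hl).isInvariant_eqState irreducible).headProb_eq irreducible]
  simp only [hprod]
  rw [div_eq_mul_inv, mul_comm]
  congr 1
  rw [sum_dedge]
  simp only [edgeFn_loop_left, edgeFn_loop_right, edgeFn_bridge, edgeFn_bridge_rev, bridgeMass]
  generalize Real.exp (l (0 : Fin 3)) = x at *
  generalize Real.exp (l (1 : Fin 3)) = y at *
  have hx1 := (sub_pos.2 hx).ne'
  have hy1 := (sub_pos.2 hy).ne'
  have hD := (denom_pos hx hy).ne'
  rw [inv_eq_iff_eq_inv, inv_div]
  field_simp
  ring

/-- The squares in `variance` are weighted by the variance x/(x - 1)² of the geometric number of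
turns in one visit to a loop. Separate visits are independent, so the two loops give no cross term.
-/
theorem tendsto_varianceSeq (hl : OnSurface l) (φ : dumbbell.EdgeFun) :
    Tendsto (varianceSeq (onPath φ) (eqState l)) atTop (𝓝 (variance l φ)) := by
  have hx := Real.one_lt_exp_iff.2 hl.pos_left
  have hy := Real.one_lt_exp_iff.2 hl.pos_right
  convert ((perron hl).isInvariant_eqState irreducible).tendsto_varianceSeq (poisson_eq hl φ)
    using 2
  have h := sum_sub_meanValue hl φ
  rw [sum_dedge]
  simp only [headProb_eqState hl, sum_backward_mul hl]
  simp only [poisson, if_true, if_false, Bool.false_eq_true, edgeFn_loop_left, edgeFn_loop_right,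
      edgeFn_bridge, edgeFn_bridge_rev, Matrix.cons_val_zero, Matrix.cons_val_one,
      Matrix.cons_val, variance]
  generalize bridgeMass _ _ = k at *
  generalize meanValue l φ = c at *
  generalize Real.exp (l (0 : Fin 3)) = x at *
  generalize Real.exp (l (1 : Fin 3)) = y at *
  have hx1 := (sub_pos.2 hx).ne'
  have hy1 := (sub_pos.2 hy).ne'
  have h2 : φ (2 : Fin 3) - c = -(x / (x - 1) * (φ (0 : Fin 3) - c) +
    y / (y - 1) * (φ (1 : Fin 3) - c)) / 2 := by linarith
  rw [h2]
  generalize φ (0 : Fin 3) - c = α at *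
  generalize φ (1 : Fin 3) - c = β at *
  field_simp
  ring

theorem pressureSq_eq (hl : OnSurface l) (φ : dumbbell.EdgeFun) :
    pressureSq l φ = variance l φ :=
  (tendsto_varianceSeq hl φ).limUnder_eq

theorem existsUnique_isEquilibriumState (hl : OnSurface l) :
    ∃! m, IsEquilibriumState (fun x => - onPath l x) m :=
  (perron hl).existsUnique_isEquilibriumState irreducible

end Dumbbell

/-! ### Partial derivatives along coordinate lines -/

theorem partialD_congr {F : Type*} [NormedAddCommGroup F] [NormedSpace ℝ F] {f g : (Fin 2 → ℝ) → F}
    {p : Fin 2 → ℝ} (h : f =ᶠ[𝓝 p] g) (i : Fin 2) : partialD i f p = partialD i g p :=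
  h.lineDeriv_eq

theorem partialD_zero_eq {F : Type*} [NormedAddCommGroup F] [NormedSpace ℝ F]
    {f : (Fin 2 → ℝ) → F} {p : Fin 2 → ℝ} {f' : F}
    (h : HasDerivAt (fun s => f ![s, p 1]) f' (p 0)) : partialD 0 f p = f' := by
  refine HasLineDerivAt.lineDeriv ?_
  have h1 : HasDerivAt (fun t : ℝ => f ![p 0 + t, p 1]) f' 0 :=
    HasDerivAt.comp_const_add (f := fun s => f ![s, p 1]) (p 0) 0 (by simpa using h)
  have h2 : (fun t : ℝ => f (p + t • Pi.single (0 : Fin 2) (1 : ℝ))) =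
      fun t => f ![p 0 + t, p 1] := by
    funext t
    congr 1
    ext i
    fin_cases i <;> simp
  rw [HasLineDerivAt, h2]
  exact h1

theorem partialD_one_eq {F : Type*} [NormedAddCommGroup F] [NormedSpace ℝ F]
    {f : (Fin 2 → ℝ) → F} {p : Fin 2 → ℝ} {f' : F}
    (h : HasDerivAt (fun s => f ![p 0, s]) f' (p 1)) : partialD 1 f p = f' := by
  refine HasLineDerivAt.lineDeriv ?_
  have h1 : HasDerivAt (fun t : ℝ => f ![p 0, p 1 + t]) f' 0 :=
    HasDerivAt.comp_const_add (f := fun s => f ![p 0, s]) (p 1) 0 (by simpa using h)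
  have h2 : (fun t : ℝ => f (p + t • Pi.single (1 : Fin 2) (1 : ℝ))) =
      fun t => f ![p 0, p 1 + t] := by
    funext t
    congr 1
    ext i
    fin_cases i <;> simp
  rw [HasLineDerivAt, h2]
  exact h1

/-! ### The first fundamental form and its curvature -/

namespace Dumbbell

open FinGraph

/-- The open quadrant `x, y > 0`. -/
def quadrant : Set (Fin 2 → ℝ) := {p | 0 < p 0 ∧ 0 < p 1}

theorem isOpen_quadrant : IsOpen quadrant :=
  (isOpen_lt continuous_const (continuous_apply 0)).inter
    (isOpen_lt continuous_const (continuous_apply 1))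

theorem domain_subset : dumbbellDomain ⊆ quadrant := fun _ hp => ⟨hp.1, hp.2.1⟩

/-- The third component of the vectors tangent to the surface. -/
def tangentBridge (l : dumbbell.EdgeFun) (a b : ℝ) : ℝ :=
  -(1 / 2) * (Real.exp (l (0 : Fin 3)) / (Real.exp (l (0 : Fin 3)) - 1) * a +
    Real.exp (l (1 : Fin 3)) / (Real.exp (l (1 : Fin 3)) - 1) * b)

/-- Derivatives within a set serve both the partial derivatives of the chart and the velocities of
curves on [0, 1]. -/
theorem hasDerivWithinAt_bridge {f g : ℝ → ℝ} {f' g' t : ℝ} {s : Set ℝ}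
    (hf : HasDerivWithinAt f f' s t) (hg : HasDerivWithinAt g g' s t) (hf0 : 0 < f t)
    (hg0 : 0 < g t) :
    HasDerivWithinAt (fun t => dumbbellChart ![f t, g t] (2 : Fin 3))
      (tangentBridge (dumbbellChart ![f t, g t]) f' g') s t := by
  have h1 := sub_pos.2 (Real.one_lt_exp_iff.2 hf0)
  have h2 := sub_pos.2 (Real.one_lt_exp_iff.2 hg0)
  have h := ((((hf.exp.sub_const 1).mul (hg.exp.sub_const 1)).log (mul_pos h1 h2).ne').const_mul
    (1 / 2)).const_sub (Real.log 2)
  refine h.congr_deriv ?_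
  change _ = -(1 / 2) * (Real.exp (f t) / (Real.exp (f t) - 1) * f' +
    Real.exp (g t) / (Real.exp (g t) - 1) * g')
  simp only [Pi.mul_apply]
  field_simp

theorem hasDerivWithinAt_chart {f g : ℝ → ℝ} {f' g' t : ℝ} {s : Set ℝ}
    (hf : HasDerivWithinAt f f' s t) (hg : HasDerivWithinAt g g' s t) (hf0 : 0 < f t)
    (hg0 : 0 < g t) :
    HasDerivWithinAt (fun t => dumbbellChart ![f t, g t])
      (![f', g', tangentBridge (dumbbellChart ![f t, g t]) f' g'] : Fin 3 → ℝ) s t := by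
  have : ∀ i : Fin 3, HasDerivWithinAt (fun t => dumbbellChart ![f t, g t] i)
      ((![f', g', tangentBridge (dumbbellChart ![f t, g t]) f' g'] : Fin 3 → ℝ) i) s t :=
    Fin.forall_fin_succ.2 ⟨hf, Fin.forall_fin_two.2 ⟨hg, hasDerivWithinAt_bridge hf hg hf0 hg0⟩⟩
  exact hasDerivWithinAt_pi.2 this

theorem vec_eta (p : Fin 2 → ℝ) : ![p 0, p 1] = p := by
  ext i; fin_cases i <;> rfl

theorem partialD_zero_chart {p : Fin 2 → ℝ} (hp : p ∈ quadrant) : partialD 0 dumbbellChart p =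
    (![1, 0, tangentBridge (dumbbellChart p) 1 0] : Fin 3 → ℝ) := by
  refine partialD_zero_eq ?_
  have := hasDerivWithinAt_univ.1 <| hasDerivWithinAt_chart (s := Set.univ)
    (f := fun s => s) (g := fun _ => p 1)
    (hasDerivWithinAt_id (p 0) _) (hasDerivWithinAt_const _ _ _) hp.1 hp.2
  simpa only [vec_eta] using this

theorem partialD_one_chart {p : Fin 2 → ℝ} (hp : p ∈ quadrant) : partialD 1 dumbbellChart p =
    (![0, 1, tangentBridge (dumbbellChart p) 0 1] : Fin 3 → ℝ) := by
  refine partialD_one_eq ?_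
  have := hasDerivWithinAt_univ.1 <| hasDerivWithinAt_chart (s := Set.univ)
    (f := fun _ => p 0) (g := fun s => s)
    (hasDerivWithinAt_const _ _ _) (hasDerivWithinAt_id (p 1) _) hp.1 hp.2
  simpa only [vec_eta] using this

/-- Tangency to the surface is the vanishing of the mean. The variance of a tangent vector is then a
diagonal quadratic form in its two loop components. -/
theorem meanValue_tangent {l φ : dumbbell.EdgeFun}
    (h : φ (2 : Fin 3) = tangentBridge l (φ (0 : Fin 3)) (φ (1 : Fin 3))) : meanValue l φ = 0 := by
  rw [meanValue, h, tangentBridge]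
  ring

theorem pressureSq_tangent {l φ : dumbbell.EdgeFun} (hl : OnSurface l)
    (h : φ (2 : Fin 3) = tangentBridge l (φ (0 : Fin 3)) (φ (1 : Fin 3))) : pressureSq l φ =
    bridgeMass (Real.exp (l (0 : Fin 3))) (Real.exp (l (1 : Fin 3))) *
      (Real.exp (l (0 : Fin 3)) / (Real.exp (l (0 : Fin 3)) - 1) ^ 2 * φ (0 : Fin 3) ^ 2 +
        Real.exp (l (1 : Fin 3)) / (Real.exp (l (1 : Fin 3)) - 1) ^ 2 * φ (1 : Fin 3) ^ 2) := by
  rw [pressureSq_eq hl, variance, meanValue_tangent h, sub_zero, sub_zero]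

theorem pressureInner_tangent {l φ ψ : dumbbell.EdgeFun} (hl : OnSurface l)
    (hφ : φ (2 : Fin 3) = tangentBridge l (φ (0 : Fin 3)) (φ (1 : Fin 3)))
    (hψ : ψ (2 : Fin 3) = tangentBridge l (ψ (0 : Fin 3)) (ψ (1 : Fin 3))) : pressureInner l φ ψ =
    bridgeMass (Real.exp (l (0 : Fin 3))) (Real.exp (l (1 : Fin 3))) *
      (Real.exp (l (0 : Fin 3)) / (Real.exp (l (0 : Fin 3)) - 1) ^ 2 *
          (φ (0 : Fin 3) * ψ (0 : Fin 3)) +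
        Real.exp (l (1 : Fin 3)) / (Real.exp (l (1 : Fin 3)) - 1) ^ 2 *
          (φ (1 : Fin 3) * ψ (1 : Fin 3))) := by
  have hsum : (φ + ψ) (2 : Fin 3) =
      tangentBridge l ((φ + ψ) (0 : Fin 3)) ((φ + ψ) (1 : Fin 3)) := by
    change φ (2 : Fin 3) + ψ (2 : Fin 3) =
      tangentBridge l (φ (0 : Fin 3) + ψ (0 : Fin 3)) (φ (1 : Fin 3) + ψ (1 : Fin 3))
    rw [hφ, hψ]
    simp only [tangentBridge]
    ring
  rw [pressureInner, pressureSq_tangent hl hφ, pressureSq_tangent hl hψ, pressureSq_tangent hl hsum]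
  have h0 : (φ + ψ) (0 : Fin 3) = φ (0 : Fin 3) + ψ (0 : Fin 3) := rfl
  have h1 : (φ + ψ) (1 : Fin 3) = φ (1 : Fin 3) + ψ (1 : Fin 3) := rfl
  rw [h0, h1]
  ring

/-- The coefficient of `dx²` of the metric in terms of `a = eˣ`, `b = eʸ`. -/
def metricCoeff (a b : ℝ) : ℝ := a * (b - 1) / ((a - 1) * (4 * a * b - 3 * a - 3 * b + 2))

theorem form_eq {p : Fin 2 → ℝ} (hp : p ∈ quadrant) : dumbbellForm p =
    !![metricCoeff (Real.exp (p 0)) (Real.exp (p 1)), 0;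
      0, metricCoeff (Real.exp (p 1)) (Real.exp (p 0))] := by
  have hs := onSurface_chart hp.1 hp.2
  have hx := Real.one_lt_exp_iff.2 hp.1
  have hy := Real.one_lt_exp_iff.2 hp.2
  have e0 : dumbbellChart p (0 : Fin 3) = p 0 := rfl
  have e1 : dumbbellChart p (1 : Fin 3) = p 1 := rfl
  have h : ∀ i j, dumbbellForm p i j =
      pressureInner (dumbbellChart p) (partialD i dumbbellChart p) (partialD j dumbbellChart p) :=
    fun i j => rfl
  have hE : bridgeMass (Real.exp (p 0)) (Real.exp (p 1)) *
      (Real.exp (p 0) / (Real.exp (p 0) - 1) ^ 2) =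
      metricCoeff (Real.exp (p 0)) (Real.exp (p 1)) := by
    have := (denom_pos hx hy).ne'
    have := (sub_pos.2 hx).ne'
    rw [bridgeMass, metricCoeff, div_mul_div_comm, div_eq_div_iff (by positivity) (by positivity)]
    ring
  have hG : bridgeMass (Real.exp (p 0)) (Real.exp (p 1)) *
      (Real.exp (p 1) / (Real.exp (p 1) - 1) ^ 2) =
      metricCoeff (Real.exp (p 1)) (Real.exp (p 0)) := by
    have := (denom_pos hx hy).ne'
    have := (denom_pos hy hx).ne'
    have := (sub_pos.2 hy).ne'
    rw [bridgeMass, metricCoeff, div_mul_div_comm, div_eq_div_iff (by positivity) (by positivity)]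
    ring
  have h00 := pressureInner_tangent hs (φ := (![1, 0, tangentBridge (dumbbellChart p) 1 0] :
    Fin 3 → ℝ)) (ψ := (![1, 0, tangentBridge (dumbbellChart p) 1 0] : Fin 3 → ℝ)) rfl rfl
  have h01 := pressureInner_tangent hs (φ := (![1, 0, tangentBridge (dumbbellChart p) 1 0] :
    Fin 3 → ℝ)) (ψ := (![0, 1, tangentBridge (dumbbellChart p) 0 1] : Fin 3 → ℝ)) rfl rfl
  have h10 := pressureInner_tangent hs (φ := (![0, 1, tangentBridge (dumbbellChart p) 0 1] :
    Fin 3 → ℝ)) (ψ := (![1, 0, tangentBridge (dumbbellChart p) 1 0] : Fin 3 → ℝ)) rfl rfl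
  have h11 := pressureInner_tangent hs (φ := (![0, 1, tangentBridge (dumbbellChart p) 0 1] :
    Fin 3 → ℝ)) (ψ := (![0, 1, tangentBridge (dumbbellChart p) 0 1] : Fin 3 → ℝ)) rfl rfl
  ext i j
  fin_cases i <;> fin_cases j <;>
    simp only [Fin.zero_eta, Fin.mk_one, h, partialD_zero_chart hp, partialD_one_chart hp, h00, h01,
      h10, h11, e0, e1] <;> simp [hE, hG]

theorem metricCoeff_pos {a b : ℝ} (ha : 1 < a) (hb : 1 < b) : 0 < metricCoeff a b := by
  have h1 := sub_pos.2 ha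
  have h2 := sub_pos.2 hb
  have h3 := denom_pos ha hb
  unfold metricCoeff
  positivity

theorem contDiffOn_metricCoeff {f g : (Fin 2 → ℝ) → ℝ} (hf : ContDiff ℝ (⊤ : ℕ∞) f)
    (hg : ContDiff ℝ (⊤ : ℕ∞) g) {s : Set (Fin 2 → ℝ)} (hf0 : ∀ p ∈ s, 0 < f p)
    (hg0 : ∀ p ∈ s, 0 < g p) :
    ContDiffOn ℝ (⊤ : ℕ∞) (fun p => metricCoeff (Real.exp (f p)) (Real.exp (g p))) s := by
  unfold metricCoeff
  refine ContDiffOn.div (ContDiff.contDiffOn (by fun_prop)) (ContDiff.contDiffOn (by fun_prop)) ?_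
  intro p hp
  have h1 := Real.one_lt_exp_iff.2 (hf0 p hp)
  have h2 := Real.one_lt_exp_iff.2 (hg0 p hp)
  exact (mul_pos (sub_pos.2 h1) (denom_pos h1 h2)).ne'

theorem contDiffOn_form (i j : Fin 2) :
    ContDiffOn ℝ (⊤ : ℕ∞) (fun p => dumbbellForm p i j) dumbbellDomain := by
  have h0 : ContDiff ℝ (⊤ : ℕ∞) fun p : Fin 2 → ℝ => p 0 := by fun_prop
  have h1 : ContDiff ℝ (⊤ : ℕ∞) fun p : Fin 2 → ℝ => p 1 := by fun_prop
  have hE := contDiffOn_metricCoeff h0 h1 (s := dumbbellDomain) (fun p hp => hp.1)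
    fun p hp => hp.2.1
  have hG := contDiffOn_metricCoeff h1 h0 (s := dumbbellDomain) (fun p hp => hp.2.1)
    fun p hp => hp.1
  have h : ∀ p ∈ dumbbellDomain, dumbbellForm p i j =
      !![metricCoeff (Real.exp (p 0)) (Real.exp (p 1)), 0;
      0, metricCoeff (Real.exp (p 1)) (Real.exp (p 0))] i j := fun p hp => by
    rw [form_eq (domain_subset hp)]
  refine ContDiffOn.congr ?_ h
  fin_cases i <;> fin_cases j
  · simpa using hE
  · simpa using contDiffOn_const
  · simpa using contDiffOn_const
  · simpa using hG

/-- Half the logarithmic derivative of the coefficient of `dx²` with respect to `x`. -/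
def logDerivCoeff (a b : ℝ) : ℝ :=
  (-1 / (a - 1) - a * (4 * b - 3) / (4 * a * b - 3 * a - 3 * b + 2)) / 2

theorem hasDerivAt_metricCoeff_left {s b : ℝ} (hs : 0 < s) (hb : 1 < b) :
    HasDerivAt (fun s => metricCoeff (Real.exp s) b)
      (2 * logDerivCoeff (Real.exp s) b * metricCoeff (Real.exp s) b) s := by
  have ha := Real.one_lt_exp_iff.2 hs
  have h1 := (sub_pos.2 ha).ne'
  have hD := (denom_pos ha hb).ne'
  have h := ((Real.hasDerivAt_exp s).mul_const (b - 1)).div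
    (((Real.hasDerivAt_exp s).sub_const 1).mul
      ((((((Real.hasDerivAt_exp s).const_mul 4).mul_const b).sub
        ((Real.hasDerivAt_exp s).const_mul 3)).sub_const (3 * b)).add_const 2)) (mul_ne_zero h1 hD)
  refine h.congr_deriv ?_
  simp only [Pi.mul_apply, Pi.sub_apply, logDerivCoeff, metricCoeff]
  generalize Real.exp s = a at *
  obtain ⟨D, hDe⟩ : ∃ D, D = 4 * a * b - 3 * a - 3 * b + 2 := ⟨_, rfl⟩
  rw [← hDe] at hD ⊢
  field_simp
  ring

/-- The coefficient E = k a/(a - 1)² depends on y only through k = `bridgeMass`, and the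
y-derivative of log k is G. Hence E_y = EG, and by symmetry G_x = EG; this keeps all Christoffel
symbols free of quotients of E and G. -/
theorem hasDerivAt_metricCoeff_right {a s : ℝ} (ha : 1 < a) (hs : 0 < s) :
    HasDerivAt (fun s => metricCoeff a (Real.exp s))
      (metricCoeff a (Real.exp s) * metricCoeff (Real.exp s) a) s := by
  have hb := Real.one_lt_exp_iff.2 hs
  have h1 := (sub_pos.2 ha).ne'
  have h2 := (sub_pos.2 hb).ne'
  have hD := (denom_pos ha hb).ne'
  have h := (((Real.hasDerivAt_exp s).sub_const 1).const_mul a).div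
    (((((Real.hasDerivAt_exp s).const_mul (4 * a)).sub_const (3 * a)).sub
        ((Real.hasDerivAt_exp s).const_mul 3)).add_const 2 |>.const_mul (a - 1))
          (mul_ne_zero h1 hD)
  refine h.congr_deriv ?_
  simp only [Pi.sub_apply, metricCoeff]
  generalize Real.exp s = b at *
  rw [show 4 * a * b - 3 * a - 3 * b + 2 = 4 * b * a - 3 * b - 3 * a + 2 by ring] at hD ⊢
  obtain ⟨D, hDe⟩ : ∃ D, D = 4 * b * a - 3 * b - 3 * a + 2 := ⟨_, rfl⟩
  rw [← hDe] at hD ⊢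
  field_simp
  rw [hDe]
  ring

/-- The coefficient of `dx²` in the coordinates. -/
def coeffE (p : Fin 2 → ℝ) : ℝ := metricCoeff (Real.exp (p 0)) (Real.exp (p 1))

/-- The coefficient of `dy²` in the coordinates. -/
def coeffG (p : Fin 2 → ℝ) : ℝ := metricCoeff (Real.exp (p 1)) (Real.exp (p 0))

/-- Half the derivative of `log E` with respect to `x`. -/
def halfLogE (p : Fin 2 → ℝ) : ℝ := logDerivCoeff (Real.exp (p 0)) (Real.exp (p 1))

/-- Half the derivative of `log G` with respect to `y`. -/
def halfLogG (p : Fin 2 → ℝ) : ℝ := logDerivCoeff (Real.exp (p 1)) (Real.exp (p 0))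

variable {p : Fin 2 → ℝ}

theorem coeffE_pos (hp : p ∈ quadrant) : 0 < coeffE p :=
  metricCoeff_pos (Real.one_lt_exp_iff.2 hp.1) (Real.one_lt_exp_iff.2 hp.2)

theorem coeffG_pos (hp : p ∈ quadrant) : 0 < coeffG p :=
  metricCoeff_pos (Real.one_lt_exp_iff.2 hp.2) (Real.one_lt_exp_iff.2 hp.1)

theorem form_entries (hp : p ∈ quadrant) : dumbbellForm p = !![coeffE p, 0; 0, coeffG p] :=
  form_eq hp

theorem hasDerivAt_coeffE_zero (hp : p ∈ quadrant) :
    HasDerivAt (fun s => coeffE ![s, p 1]) (2 * halfLogE p * coeffE p) (p 0) :=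
  hasDerivAt_metricCoeff_left hp.1 (Real.one_lt_exp_iff.2 hp.2)

theorem hasDerivAt_coeffE_one (hp : p ∈ quadrant) :
    HasDerivAt (fun s => coeffE ![p 0, s]) (coeffE p * coeffG p) (p 1) :=
  hasDerivAt_metricCoeff_right (Real.one_lt_exp_iff.2 hp.1) hp.2

theorem hasDerivAt_coeffG_zero (hp : p ∈ quadrant) :
    HasDerivAt (fun s => coeffG ![s, p 1]) (coeffE p * coeffG p) (p 0) := by
  rw [mul_comm]
  exact hasDerivAt_metricCoeff_right (Real.one_lt_exp_iff.2 hp.2) hp.1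

theorem hasDerivAt_coeffG_one (hp : p ∈ quadrant) :
    HasDerivAt (fun s => coeffG ![p 0, s]) (2 * halfLogG p * coeffG p) (p 1) :=
  hasDerivAt_metricCoeff_left hp.2 (Real.one_lt_exp_iff.2 hp.1)

theorem partialD_form (hp : p ∈ quadrant) (i j k : Fin 2) :
    partialD k (fun q => dumbbellForm q i j) p =
      partialD k (fun q => !![coeffE q, 0; 0, coeffG q] i j) p := by
  refine partialD_congr ?_ k
  filter_upwards [isOpen_quadrant.mem_nhds hp] with q hq
  rw [form_entries hq]

theorem partialD_const (c : ℝ) (k : Fin 2) : partialD k (fun _ : Fin 2 → ℝ => c) p = 0 := by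
  simp [partialD, lineDeriv]

theorem inv_form (hp : p ∈ quadrant) :
    (dumbbellForm p)⁻¹ = !![(coeffE p)⁻¹, 0; 0, (coeffG p)⁻¹] := by
  have hE := (coeffE_pos hp).ne'
  have hG := (coeffG_pos hp).ne'
  rw [form_entries hp]
  refine Matrix.inv_eq_right_inv ?_
  simp [hE, hG, Matrix.one_fin_two]

theorem christoffel_form (hp : p ∈ quadrant) (k i j : Fin 2) :
    christoffel dumbbellForm k i j p =
      (![!![halfLogE p, coeffG p / 2; coeffG p / 2, -(coeffG p / 2)],
        !![-(coeffE p / 2), coeffE p / 2; coeffE p / 2, halfLogG p]] :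
        Fin 2 → Matrix (Fin 2) (Fin 2) ℝ) k i j := by
  have hE := (coeffE_pos hp).ne'
  have hG := (coeffG_pos hp).ne'
  rw [christoffel, inv_form hp, Fin.sum_univ_two]
  simp only [partialD_form hp]
  have e0 := partialD_zero_eq (hasDerivAt_coeffE_zero hp)
  have e1 := partialD_one_eq (hasDerivAt_coeffE_one hp)
  have g0 := partialD_zero_eq (hasDerivAt_coeffG_zero hp)
  have g1 := partialD_one_eq (hasDerivAt_coeffG_one hp)
  fin_cases k <;> fin_cases i <;> fin_cases j <;>
    simp [partialD_const, e0, e1, g0, g1] <;> field_simp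

theorem partialD_christoffel (hp : p ∈ quadrant) (k i j m : Fin 2) :
    partialD m (christoffel dumbbellForm k i j) p = partialD m (fun q =>
      (![!![halfLogE q, coeffG q / 2; coeffG q / 2, -(coeffG q / 2)],
        !![-(coeffE q / 2), coeffE q / 2; coeffE q / 2, halfLogG q]] :
        Fin 2 → Matrix (Fin 2) (Fin 2) ℝ) k i j) p := by
  refine partialD_congr ?_ m
  filter_upwards [isOpen_quadrant.mem_nhds hp] with q hq
  rw [christoffel_form hq]

theorem gaussCurvature_form (hp : p ∈ quadrant) : gaussCurvature dumbbellForm p =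
    (2 * Real.exp (p 0 + p 1) - 1) /
      (4 * Real.exp (p 0 + p 1) - 3 * Real.exp (p 0) - 3 * Real.exp (p 1) + 2) := by
  have hE := (coeffE_pos hp).ne'
  have hG := (coeffG_pos hp).ne'
  -- As F = 0, only R(∂₁, ∂₂)∂₂ along ∂₁ counts. It differentiates the symbols -G/2 and G/2, so no
  -- second derivatives of the metric have to be computed.
  have h1 : gaussCurvature dumbbellForm p =
      -(coeffE p + coeffG p + 2 * halfLogE p + 2 * halfLogG p) / 4 := by
    have d0 : partialD 0 (fun q => -(coeffG q / 2)) p = -(coeffE p * coeffG p / 2) :=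
      partialD_zero_eq ((hasDerivAt_coeffG_zero hp).div_const 2).neg
    have d1 : partialD 1 (fun q => coeffG q / 2) p = 2 * halfLogG p * coeffG p / 2 :=
      partialD_one_eq ((hasDerivAt_coeffG_one hp).div_const 2)
    rw [gaussCurvature, Fin.sum_univ_two]
    simp only [curvatureTensor, Fin.sum_univ_two, partialD_christoffel hp, christoffel_form hp,
      form_entries hp, Matrix.det_fin_two]
    simp [d0, d1]
    field_simp
    ring
  have hx := Real.one_lt_exp_iff.2 hp.1
  have hy := Real.one_lt_exp_iff.2 hp.2
  rw [h1, coeffE, coeffG, halfLogE, halfLogG, metricCoeff, metricCoeff, logDerivCoeff,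
    logDerivCoeff, Real.exp_add]
  generalize Real.exp (p 0) = a at *
  generalize Real.exp (p 1) = b at *
  have ha := (sub_pos.2 hx).ne'
  have hb := (sub_pos.2 hy).ne'
  have hD := (denom_pos hx hy).ne'
  rw [show 4 * b * a - 3 * b - 3 * a + 2 = 4 * a * b - 3 * a - 3 * b + 2 by ring,
    show 4 * (a * b) - 3 * a - 3 * b + 2 = 4 * a * b - 3 * a - 3 * b + 2 by ring]
  obtain ⟨D, hDe⟩ : ∃ D, D = 4 * a * b - 3 * a - 3 * b + 2 := ⟨_, rfl⟩
  rw [← hDe] at hD ⊢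
  field_simp
  rw [hDe]
  ring

theorem curvature_lower_bound (hp : p ∈ dumbbellDomain) : 1 / 2 ≤ gaussCurvature dumbbellForm p := by
  have hx := Real.one_lt_exp_iff.2 hp.1
  have hy := Real.one_lt_exp_iff.2 hp.2.1
  rw [gaussCurvature_form (domain_subset hp), Real.exp_add]
  have hD := denom_pos hx hy
  rw [div_le_div_iff₀ two_pos (by linarith)]
  -- After clearing denominators the claim is 3a + 3b ≥ 4, which follows from a, b > 1.
  linarith

theorem tendsto_curvature :
    Tendsto (gaussCurvature dumbbellForm) (𝓝[dumbbellDomain] 0) atTop := by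
  have hnum : Tendsto (fun p : Fin 2 → ℝ => 2 * Real.exp (p 0 + p 1) - 1)
      (𝓝[dumbbellDomain] 0) (𝓝 1) := by
    have : Continuous fun p : Fin 2 → ℝ => 2 * Real.exp (p 0 + p 1) - 1 := by fun_prop
    have h := (this.tendsto 0).mono_left (nhdsWithin_le_nhds (s := dumbbellDomain))
    norm_num at h
    exact h
  have hden : Tendsto (fun p : Fin 2 → ℝ =>
      4 * Real.exp (p 0 + p 1) - 3 * Real.exp (p 0) - 3 * Real.exp (p 1) + 2)
      (𝓝[dumbbellDomain] 0) (𝓝[>] 0) := by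
    refine tendsto_nhdsWithin_iff.2 ⟨?_, ?_⟩
    · have : Continuous fun p : Fin 2 → ℝ =>
          4 * Real.exp (p 0 + p 1) - 3 * Real.exp (p 0) - 3 * Real.exp (p 1) + 2 := by fun_prop
      have h := (this.tendsto 0).mono_left (nhdsWithin_le_nhds (s := dumbbellDomain))
      norm_num at h
      exact h
    · filter_upwards [self_mem_nhdsWithin] with p hp
      have := denom_pos (Real.one_lt_exp_iff.2 hp.1) (Real.one_lt_exp_iff.2 hp.2.1)
      rw [Set.mem_Ioi, Real.exp_add]
      linarith
  refine (hnum.pos_mul_atTop one_pos hden.inv_tendsto_nhdsGT_zero).congr' ?_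
  filter_upwards [self_mem_nhdsWithin] with p hp
  rw [gaussCurvature_form (domain_subset hp), div_eq_mul_inv]
  rfl

/-- The diagonal reaches the origin inside the domain, so divergence there does imply unboundedness.
-/
theorem neBot_nhdsWithin_domain : (𝓝[dumbbellDomain] (0 : Fin 2 → ℝ)).NeBot := by
  have h : Tendsto (fun t : ℝ => (fun _ => t : Fin 2 → ℝ)) (𝓝[>] 0) (𝓝[dumbbellDomain] 0) := by
    refine tendsto_nhdsWithin_iff.2 ⟨?_, ?_⟩
    · have : Continuous fun t : ℝ => (fun _ => t : Fin 2 → ℝ) := by fun_prop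
      exact (this.tendsto 0).mono_left nhdsWithin_le_nhds
    · have hc : Continuous fun t : ℝ => (Real.exp t - 1) * (Real.exp t - 1) := by fun_prop
      have h0 : ∀ᶠ t in 𝓝 (0 : ℝ), (Real.exp t - 1) * (Real.exp t - 1) < 4 :=
        hc.continuousAt.eventually_lt continuousAt_const (by norm_num)
      filter_upwards [self_mem_nhdsWithin, nhdsWithin_le_nhds h0] with t ht ht4
      exact ⟨ht, ht, ht4⟩
  exact h.neBot

theorem not_bddAbove_curvature : ¬ BddAbove (gaussCurvature dumbbellForm '' dumbbellDomain) := by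
  rintro ⟨C, hC⟩
  have := neBot_nhdsWithin_domain
  obtain ⟨p, hp, hpU⟩ := ((tendsto_curvature.eventually_gt_atTop C).and
    self_mem_nhdsWithin).exists
  exact absurd (hC (Set.mem_image_of_mem _ hpU)) (not_le.2 hp)

end Dumbbell

/-! ### Incompleteness -/

namespace Dumbbell

open FinGraph

theorem onSurface_of_mem {l : dumbbell.EdgeFun} (h : l ∈ dumbbell.moduliOne) : OnSurface l :=
  ((mem_moduliOne_iff l).1 h).1

/-- The mass of the bridge as a function on the moduli space. -/
def mass (l : dumbbell.EdgeFun) : ℝ :=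
  bridgeMass (Real.exp (l (0 : Fin 3))) (Real.exp (l (1 : Fin 3)))

theorem bridgeMass_pos {a b : ℝ} (ha : 1 < a) (hb : 1 < b) : 0 < bridgeMass a b :=
  div_pos (mul_pos (sub_pos.2 ha) (sub_pos.2 hb)) (denom_pos ha hb)

theorem mass_pos {l : dumbbell.EdgeFun} (hl : OnSurface l) : 0 < mass l :=
  bridgeMass_pos (Real.one_lt_exp_iff.2 hl.pos_left) (Real.one_lt_exp_iff.2 hl.pos_right)

theorem bridgeMass_cube_mul_le {a b : ℝ} (ha : 1 < a) (hb : 1 < b) :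
    bridgeMass a b ^ 3 * (a / (a - 1) ^ 2 + b / (b - 1) ^ 2) ≤ 1 := by
  -- In terms of s = 1/(a - 1) and t = 1/(b - 1) the claim becomes s² + s + t² + t ≤ (4 + s + t)³.
  obtain ⟨s, hs, rfl⟩ : ∃ s, 0 < s ∧ a = 1 / s + 1 :=
    ⟨1 / (a - 1), one_div_pos.2 (sub_pos.2 ha), by rw [one_div_one_div]; ring⟩
  obtain ⟨t, ht, rfl⟩ : ∃ t, 0 < t ∧ b = 1 / t + 1 :=
    ⟨1 / (b - 1), one_div_pos.2 (sub_pos.2 hb), by rw [one_div_one_div]; ring⟩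
  have hk : bridgeMass (1 / s + 1) (1 / t + 1) = 1 / (4 + s + t) := by
    have := denom_pos ha hb
    rw [bridgeMass, div_eq_div_iff this.ne' (by positivity)]
    field_simp
    ring
  have hA : ∀ r : ℝ, 0 < r → (1 / r + 1) / (1 / r + 1 - 1) ^ 2 = r ^ 2 + r := by
    intro r hr
    rw [add_sub_cancel_right]
    field_simp
    ring
  rw [hk, hA s hs, hA t ht, div_pow, one_pow, one_div, inv_mul_le_iff₀ (by positivity), mul_one]
  have h1 : (4 + s + t) ^ 3 = (4 + s + t) * (4 + s + t) ^ 2 := by ring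
  rw [h1]
  nlinarith [mul_pos hs ht, sq_nonneg (4 + s + t)]

variable {γ : ℝ → dumbbell.EdgeFun}

/-- On the moduli space the bridge coordinate is a function of the two loop coordinates, so its
derivative along the curve is given by the chain rule. -/
theorem tangent_of_hasDerivWithinAt (hmem : ∀ t ∈ Set.Icc (0 : ℝ) 1, γ t ∈ dumbbell.moduliOne)
    {t : ℝ} (ht : t ∈ Set.Icc (0 : ℝ) 1) {v : dumbbell.EdgeFun}
    (hv : ∀ i : Fin 3, HasDerivWithinAt (fun s => γ s i) (v i) (Set.Icc 0 1) t) :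
    v (2 : Fin 3) = tangentBridge (γ t) (v (0 : Fin 3)) (v (1 : Fin 3)) := by
  have hs := onSurface_of_mem (hmem t ht)
  have h := hasDerivWithinAt_bridge (hv 0) (hv 1) hs.pos_left hs.pos_right
  rw [← eq_chart hs] at h
  refine (uniqueDiffOn_Icc zero_lt_one t ht).eq_deriv _ (hv 2) (h.congr ?_ ?_)
  · intro s hs'
    exact congrFun (eq_chart (onSurface_of_mem (hmem s hs'))) (2 : Fin 3)
  · exact congrFun (eq_chart hs) (2 : Fin 3)

theorem hasDerivWithinAt_mass {t : ℝ} {s : Set ℝ} (hs : OnSurface (γ t)) {v : dumbbell.EdgeFun}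
    (hv : ∀ i : Fin 3, HasDerivWithinAt (fun s => γ s i) (v i) s t) :
    HasDerivWithinAt (fun s => mass (γ s)) (mass (γ t) ^ 2 *
      (Real.exp (γ t (0 : Fin 3)) / (Real.exp (γ t (0 : Fin 3)) - 1) ^ 2 * v (0 : Fin 3) +
        Real.exp (γ t (1 : Fin 3)) / (Real.exp (γ t (1 : Fin 3)) - 1) ^ 2 * v (1 : Fin 3))) s t := by
  have hx := Real.one_lt_exp_iff.2 hs.pos_left
  have hy := Real.one_lt_exp_iff.2 hs.pos_right
  have hD := (denom_pos hx hy).ne'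
  have h0 := (hv 0).exp
  have h1 := (hv 1).exp
  have h := ((h0.sub_const 1).mul (h1.sub_const 1)).div
    (((((h0.const_mul 4).mul h1).sub (h0.const_mul 3)).sub (h1.const_mul 3)).add_const 2) hD
  refine h.congr_deriv ?_
  simp only [Pi.mul_apply, Pi.sub_apply, mass, bridgeMass]
  generalize Real.exp (γ t (0 : Fin 3)) = a at *
  generalize Real.exp (γ t (1 : Fin 3)) = b at *
  have ha := (sub_pos.2 hx).ne'
  have hb := (sub_pos.2 hy).ne'
  obtain ⟨D, hDe⟩ : ∃ D, D = 4 * a * b - 3 * a - 3 * b + 2 := ⟨_, rfl⟩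
  rw [← hDe] at hD ⊢
  field_simp
  rw [hDe]
  ring

/-- The mass of the bridge is a Lipschitz function for the pressure metric. -/
theorem abs_deriv_mass_le {l v : dumbbell.EdgeFun} (hl : OnSurface l)
    (hv : v (2 : Fin 3) = tangentBridge l (v (0 : Fin 3)) (v (1 : Fin 3))) :
    |mass l ^ 2 *
      (Real.exp (l (0 : Fin 3)) / (Real.exp (l (0 : Fin 3)) - 1) ^ 2 * v (0 : Fin 3) +
        Real.exp (l (1 : Fin 3)) / (Real.exp (l (1 : Fin 3)) - 1) ^ 2 * v (1 : Fin 3))| ≤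
      Real.sqrt (pressureSq l v) := by
  have hx := Real.one_lt_exp_iff.2 hl.pos_left
  have hy := Real.one_lt_exp_iff.2 hl.pos_right
  refine Real.abs_le_sqrt ?_
  rw [pressureSq_tangent hl hv, mass]
  have hk := bridgeMass_pos hx hy
  have hle := bridgeMass_cube_mul_le hx hy
  have hA : 0 < Real.exp (l (0 : Fin 3)) / (Real.exp (l (0 : Fin 3)) - 1) ^ 2 :=
    div_pos (Real.exp_pos _) (pow_pos (sub_pos.2 hx) 2)
  have hB : 0 < Real.exp (l (1 : Fin 3)) / (Real.exp (l (1 : Fin 3)) - 1) ^ 2 :=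
    div_pos (Real.exp_pos _) (pow_pos (sub_pos.2 hy) 2)
  generalize bridgeMass _ _ = k at *
  generalize Real.exp (l (0 : Fin 3)) / (Real.exp (l (0 : Fin 3)) - 1) ^ 2 = A at *
  generalize Real.exp (l (1 : Fin 3)) / (Real.exp (l (1 : Fin 3)) - 1) ^ 2 = B at *
  generalize v (0 : Fin 3) = p
  generalize v (1 : Fin 3) = q
  -- Cauchy–Schwarz with weights A, B; the factor left over is k³(A + B) ≤ 1.
  have hcs : (A * p + B * q) ^ 2 ≤ (A + B) * (A * p ^ 2 + B * q ^ 2) := by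
    have : (A + B) * (A * p ^ 2 + B * q ^ 2) - (A * p + B * q) ^ 2 = A * B * (p - q) ^ 2 := by ring
    have : 0 ≤ A * B * (p - q) ^ 2 := by positivity
    linarith
  calc (k ^ 2 * (A * p + B * q)) ^ 2 = k ^ 4 * (A * p + B * q) ^ 2 := by ring
    _ ≤ k ^ 4 * ((A + B) * (A * p ^ 2 + B * q ^ 2)) :=
      mul_le_mul_of_nonneg_left hcs (by positivity)
    _ = k ^ 3 * (A + B) * (k * (A * p ^ 2 + B * q ^ 2)) := by ring
    _ ≤ 1 * (k * (A * p ^ 2 + B * q ^ 2)) := mul_le_mul_of_nonneg_right hle (by positivity)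
    _ = k * (A * p ^ 2 + B * q ^ 2) := one_mul _

theorem contDiffOn_mass (hγ : ContDiffOn ℝ 1 γ (Set.Icc 0 1))
    (hmem : ∀ t ∈ Set.Icc (0 : ℝ) 1, γ t ∈ dumbbell.moduliOne) :
    ContDiffOn ℝ 1 (fun t => mass (γ t)) (Set.Icc 0 1) := by
  have h : ∀ i : Fin 3, ContDiffOn ℝ 1 (fun t => γ t i) (Set.Icc 0 1) := contDiffOn_pi.1 hγ
  have h0 := (h 0).exp
  have h1 := (h 1).exp
  refine ((h0.sub contDiffOn_const).mul (h1.sub contDiffOn_const)).div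
    (((((contDiffOn_const.mul h0).mul h1).sub (contDiffOn_const.mul h0)).sub
      (contDiffOn_const.mul h1)).add contDiffOn_const) fun t ht => ?_
  have hs := onSurface_of_mem (hmem t ht)
  exact (denom_pos (Real.one_lt_exp_iff.2 hs.pos_left) (Real.one_lt_exp_iff.2 hs.pos_right)).ne'

theorem hasDerivWithinAt_coord (hγ : ContDiffOn ℝ 1 γ (Set.Icc 0 1)) {t : ℝ}
    (ht : t ∈ Set.Icc (0 : ℝ) 1) (i : Fin 3) :
    HasDerivWithinAt (fun s => γ s i) (derivWithin γ (Set.Icc 0 1) t i) (Set.Icc 0 1) t :=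
  hasDerivWithinAt_pi.1 ((hγ.differentiableOn one_ne_zero) t ht).hasDerivWithinAt i

theorem enorm_mass_sub_le_pressureLength (hγ : ContDiffOn ℝ 1 γ (Set.Icc 0 1))
    (hmem : ∀ t ∈ Set.Icc (0 : ℝ) 1, γ t ∈ dumbbell.moduliOne) :
    ‖mass (γ 1) - mass (γ 0)‖ₑ ≤ pressureLength γ := by
  refine (enorm_sub_le_lintegral_derivWithin_Icc_of_contDiffOn_Icc (contDiffOn_mass hγ hmem)
    zero_le_one).trans ?_
  refine setLIntegral_mono' measurableSet_Icc fun t ht => ?_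
  have hs := onSurface_of_mem (hmem t ht)
  have hv := hasDerivWithinAt_coord hγ ht
  rw [(hasDerivWithinAt_mass hs hv).derivWithin (uniqueDiffOn_Icc zero_lt_one t ht),
    Real.enorm_eq_ofReal_abs]
  exact ENNReal.ofReal_le_ofReal (abs_deriv_mass_le hs (tangent_of_hasDerivWithinAt hmem ht hv))

theorem enorm_mass_sub_le_pressureDist (l₁ l₂ : dumbbell.EdgeFun) :
    ‖mass l₂ - mass l₁‖ₑ ≤ pressureDist l₁ l₂ := by
  refine le_iInf₂ fun γ hγ => ?_
  obtain ⟨h1, h2, rfl, rfl⟩ := hγ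
  exact enorm_mass_sub_le_pressureLength h1 h2

/-- A curve of finite length that leaves the moduli space at `r = 0`. -/
def escape (r : ℝ) : dumbbell.EdgeFun := dumbbellChart ![Real.log (1 + r ^ 2), Real.log 2]

theorem log_one_add_sq_pos {r : ℝ} (hr : 0 < r) : 0 < Real.log (1 + r ^ 2) :=
  Real.log_pos (by have := pow_pos hr 2; linarith)

theorem exp_log_one_add_sq (r : ℝ) : Real.exp (Real.log (1 + r ^ 2)) = 1 + r ^ 2 :=
  Real.exp_log (by positivity)

theorem escape_mem {r : ℝ} (hr : 0 < r) (hr1 : r ≤ 1) : escape r ∈ dumbbell.moduliOne := by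
  rw [moduliOne_eq]
  refine ⟨_, ⟨log_one_add_sq_pos hr, Real.log_pos one_lt_two, ?_⟩, rfl⟩
  change (Real.exp (Real.log (1 + r ^ 2)) - 1) * (Real.exp (Real.log 2) - 1) < 4
  rw [exp_log_one_add_sq, Real.exp_log two_pos]
  nlinarith

theorem mass_escape (r : ℝ) : mass (escape r) = r ^ 2 / (5 * r ^ 2 + 1) := by
  change bridgeMass (Real.exp (Real.log (1 + r ^ 2))) (Real.exp (Real.log 2)) = _
  rw [exp_log_one_add_sq, Real.exp_log two_pos, bridgeMass]
  congr 1 <;> ring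

theorem contDiffOn_escape : ContDiffOn ℝ 1 escape (Set.Ioi 0) := by
  have hx : ContDiffOn ℝ 1 (fun r : ℝ => Real.log (1 + r ^ 2)) (Set.Ioi 0) :=
    ContDiffOn.log (ContDiff.contDiffOn (by fun_prop)) fun r _ => by positivity
  have hc : ContDiffOn ℝ 1 (fun _ : ℝ => Real.exp (Real.log 2) - 1) (Set.Ioi 0) :=
    contDiffOn_const
  have h : ∀ i : Fin 3, ContDiffOn ℝ 1 (fun r => escape r i) (Set.Ioi 0) := by
    refine Fin.forall_fin_succ.2 ⟨hx, Fin.forall_fin_two.2 ⟨contDiffOn_const, ?_⟩⟩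
    refine contDiffOn_const.sub (contDiffOn_const.mul (ContDiffOn.log
      ((hx.exp.sub contDiffOn_const).mul hc) fun r hr => ?_))
    have h1 := sub_pos.2 (Real.one_lt_exp_iff.2 (log_one_add_sq_pos hr))
    have h2 := sub_pos.2 (Real.one_lt_exp_iff.2 (Real.log_pos one_lt_two))
    exact (mul_pos h1 h2).ne'
  exact contDiffOn_pi.2 h

/-- Along `escape` the squared speed in r is 4/((5r² + 1)(1 + r²)) ≤ 4. The substitution e^x = 1 +
r² is chosen to keep it bounded at r = 0. -/
theorem pressureDist_escape_le {r s : ℝ} (hr : 0 < r) (hr1 : r ≤ 1) (hs : 0 < s) (hs1 : s ≤ 1) :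
    pressureDist (escape r) (escape s) ≤ ENNReal.ofReal (2 * |s - r|) := by
  set ρ : ℝ → ℝ := fun t => r + t * (s - r) with hρ
  have hρmem : ∀ t ∈ Set.Icc (0 : ℝ) 1, 0 < ρ t ∧ ρ t ≤ 1 := by
    rintro t ⟨h0, h1⟩
    have : ρ t = (1 - t) * r + t * s := by simp only [hρ]; ring
    rw [this]
    constructor
    · rcases h0.eq_or_lt with rfl | h0'
      · simpa using hr
      · have := mul_pos h0' hs
        have := mul_nonneg (sub_nonneg.2 h1) hr.le
        linarith
    · nlinarith
  have hmem : ∀ t ∈ Set.Icc (0 : ℝ) 1, escape (ρ t) ∈ dumbbell.moduliOne := fun t ht =>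
    escape_mem (hρmem t ht).1 (hρmem t ht).2
  have hC : ContDiffOn ℝ 1 (fun t => escape (ρ t)) (Set.Icc 0 1) :=
    contDiffOn_escape.comp (ContDiff.contDiffOn (by fun_prop)) fun t ht => (hρmem t ht).1
  refine (iInf₂_le (fun t => escape (ρ t)) ⟨hC, hmem, by simp [hρ], by simp [hρ]⟩).trans ?_
  have hbound : ∀ t ∈ Set.Icc (0 : ℝ) 1, ENNReal.ofReal (Real.sqrt (pressureSq (escape (ρ t))
      (derivWithin (fun t => escape (ρ t)) (Set.Icc 0 1) t))) ≤ ENNReal.ofReal (2 * |s - r|) := by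
    intro t ht
    refine ENNReal.ofReal_le_ofReal ?_
    have hv := hasDerivWithinAt_coord hC ht
    have hsurf := onSurface_of_mem (hmem t ht)
    have htan := tangent_of_hasDerivWithinAt hmem ht hv
    have hu := uniqueDiffOn_Icc (zero_lt_one' ℝ) t ht
    have hρd : HasDerivWithinAt ρ (s - r) (Set.Icc 0 1) t :=
      (((hasDerivWithinAt_id t (Set.Icc 0 1)).mul_const (s - r)).const_add r).congr_deriv
        (one_mul _)
    have hx : HasDerivWithinAt (fun t => escape (ρ t) (0 : Fin 3))
        (2 * ρ t * (s - r) / (1 + ρ t ^ 2)) (Set.Icc 0 1) t := by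
      have h0 : 1 + ρ t ^ 2 ≠ 0 := by positivity
      have h := ((hρd.pow 2).const_add 1).log h0
      refine h.congr_deriv ?_
      simp
    have hy : HasDerivWithinAt (fun t => escape (ρ t) (1 : Fin 3)) 0 (Set.Icc 0 1) t :=
      hasDerivWithinAt_const _ _ _
    rw [pressureSq_tangent hsurf htan, hu.eq_deriv _ (hv 0) hx, hu.eq_deriv _ (hv 1) hy]
    have e0 : Real.exp (escape (ρ t) (0 : Fin 3)) = 1 + ρ t ^ 2 := exp_log_one_add_sq _
    have e1 : bridgeMass (Real.exp (escape (ρ t) (0 : Fin 3)))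
      (Real.exp (escape (ρ t) (1 : Fin 3))) = ρ t ^ 2 / (5 * ρ t ^ 2 + 1) := mass_escape (ρ t)
    rw [e1, e0]
    refine Real.sqrt_le_iff.2 ⟨by positivity, ?_⟩
    have hpos := (hρmem t ht).1
    rw [mul_pow, sq_abs]
    generalize ρ t = x at *
    generalize s - r = d at *
    have h1 : ∀ w : ℝ, x ^ 2 / (5 * x ^ 2 + 1) * ((1 + x ^ 2) / (1 + x ^ 2 - 1) ^ 2 *
        (2 * x * d / (1 + x ^ 2)) ^ 2 + w * 0 ^ 2) =
        2 ^ 2 * d ^ 2 * (1 / ((5 * x ^ 2 + 1) * (1 + x ^ 2))) := by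
      intro w
      rw [add_sub_cancel_left]
      field_simp
      ring
    rw [h1]
    refine mul_le_of_le_one_right (by positivity) ?_
    rw [div_le_one (by positivity)]
    nlinarith [sq_nonneg x, sq_nonneg (x ^ 2)]
  refine (setLIntegral_mono' measurableSet_Icc hbound).trans_eq ?_
  simp

/-- The points `escape (1/(n + 1))` form a Cauchy sequence whose bridge mass tends to 0. The mass is
Lipschitz for the distance, so a limit would have mass 0, while every point of the space has
positive mass. -/
theorem not_pressureComplete : ¬ dumbbell.PressureComplete := by
  intro hcomp
  have hpos : ∀ n : ℕ, (0 : ℝ) < 1 / (n + 1) := fun n => Nat.one_div_pos_of_nat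
  have hle : ∀ n : ℕ, (1 : ℝ) / (n + 1) ≤ 1 := fun n => by
    rw [div_le_one (by positivity)]
    linarith [Nat.cast_nonneg (α := ℝ) n]
  obtain ⟨l, hl, hlim⟩ := hcomp (fun n => escape (1 / (n + 1)))
    (fun n => escape_mem (hpos n) (hle n)) (by
      intro ε hε
      obtain ⟨δ, hδ, hδε⟩ : ∃ δ : ℝ, 0 < δ ∧ ENNReal.ofReal δ < ε := by
        obtain ⟨q, hq0, hq⟩ := ENNReal.lt_iff_exists_nnreal_btwn.1 hε
        exact ⟨q, by exact_mod_cast hq0, by simpa using hq⟩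
      obtain ⟨N, hN⟩ := exists_nat_one_div_lt (half_pos hδ)
      refine ⟨N, fun m hm n hn => lt_of_le_of_lt ?_ hδε⟩
      refine (pressureDist_escape_le (hpos m) (hle m) (hpos n) (hle n)).trans
        (ENNReal.ofReal_le_ofReal ?_)
      have h1 := Nat.one_div_le_one_div (α := ℝ) hm
      have h2 := Nat.one_div_le_one_div (α := ℝ) hn
      have h3 : |(1 : ℝ) / (n + 1) - 1 / (m + 1)| ≤ δ / 2 :=
        abs_le.2 ⟨by linarith [hpos n], by linarith [hpos m]⟩
      linarith)
  have hmass : Tendsto (fun n : ℕ => mass (escape (1 / (n + 1)))) atTop (𝓝 0) := by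
    have h : Tendsto (fun n : ℕ => ((1 : ℝ) / (n + 1)) ^ 2 / (5 * (1 / (n + 1)) ^ 2 + 1)) atTop
        (𝓝 (0 ^ 2 / (5 * 0 ^ 2 + 1))) := by
      have h0 := tendsto_one_div_add_atTop_nhds_zero_nat (𝕜 := ℝ)
      exact (h0.pow 2).div (((h0.pow 2).const_mul 5).add_const 1) (by norm_num)
    simpa [mass_escape] using h
  have h1 : Tendsto (fun n : ℕ => ‖mass l - mass (escape (1 / (n + 1)))‖ₑ) atTop (𝓝 0) :=
    tendsto_of_tendsto_of_tendsto_of_le_of_le tendsto_const_nhds hlim (fun _ => zero_le)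
      fun n => enorm_mass_sub_le_pressureDist _ _
  have h2 := tendsto_nhds_unique h1 (tendsto_const_nhds.sub hmass).enorm
  have h3 := mass_pos (onSurface_of_mem hl)
  rw [sub_zero] at h2
  exact h3.ne' (enorm_eq_zero.1 h2.symm)

end Dumbbell
end

theorem proposition4p8 :
    -- the entropy-one moduli space is the surface parametrized by the coordinates (x, y)
    dumbbell.moduliOne = dumbbellChart '' dumbbellDomain ∧
    -- on it the equilibrium state exists and is unique, and the variances converge
    (∀ l ∈ dumbbell.moduliOne,
      (∃! m, FinGraph.IsEquilibriumState (fun x => - FinGraph.onPath l x) m) ∧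
      ∀ φ : dumbbell.EdgeFun,
        Tendsto (FinGraph.varianceSeq (FinGraph.onPath φ) (FinGraph.eqState l)) atTop
          (𝓝 (FinGraph.pressureSq l φ))) ∧
    -- the pressure metric is a smooth Riemannian metric, diagonal in these coordinates
    (∀ i j, ContDiffOn ℝ (⊤ : ℕ∞) (fun p => dumbbellForm p i j) dumbbellDomain) ∧
    (∀ p ∈ dumbbellDomain, dumbbellForm p 0 1 = 0 ∧ dumbbellForm p 1 0 = 0 ∧
      0 < dumbbellForm p 0 0 ∧ 0 < dumbbellForm p 1 1) ∧
    -- its Gaussian curvature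
    (∀ p ∈ dumbbellDomain, gaussCurvature dumbbellForm p =
      (2 * Real.exp (p 0 + p 1) - 1) /
        (4 * Real.exp (p 0 + p 1) - 3 * Real.exp (p 0) - 3 * Real.exp (p 1) + 2)) ∧
    -- is bounded below by a positive constant,
    (∃ c : ℝ, 0 < c ∧ ∀ p ∈ dumbbellDomain, c ≤ gaussCurvature dumbbellForm p) ∧
    -- is unbounded above, and tends to infinity at the origin
    ¬ BddAbove (gaussCurvature dumbbellForm '' dumbbellDomain) ∧
    Tendsto (gaussCurvature dumbbellForm) (𝓝[dumbbellDomain] 0) atTop ∧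
    -- and the metric is incomplete
    ¬ dumbbell.PressureComplete := by
  refine ⟨Dumbbell.moduliOne_eq, fun l hl => ?_, Dumbbell.contDiffOn_form, fun p hp => ?_,
    fun p hp => Dumbbell.gaussCurvature_form (Dumbbell.domain_subset hp),
    ⟨1 / 2, one_half_pos, fun p hp => Dumbbell.curvature_lower_bound hp⟩,
    Dumbbell.not_bddAbove_curvature, Dumbbell.tendsto_curvature, Dumbbell.not_pressureComplete⟩
  · have hs := Dumbbell.onSurface_of_mem hl
    refine ⟨Dumbbell.existsUnique_isEquilibriumState hs, fun φ => ?_⟩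
    rw [Dumbbell.pressureSq_eq hs]
    exact Dumbbell.tendsto_varianceSeq hs φ
  · have hp' := Dumbbell.domain_subset hp
    rw [Dumbbell.form_entries hp']
    exact ⟨rfl, rfl, Dumbbell.coeffE_pos hp', Dumbbell.coeffG_pos hp'⟩
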